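/- Let $\mathcal Q$ be a smooth $d$-dimensional manifold and $\pi: T\mathcal Q\to\mathcal Q$ its tangent bundle. Let $S=\rho\circ T\pi$ be the vertical endomorphism of $T(T\mathcal Q)$, where $\rho_p: T_{\pi(p)}\mathcal Q\to T_p(T\mathcal Q)$ is the vertical lift; locally $S=\frac{\partial}{\partial v^i}\otimes \mathrm dq^i$. For $\mathcal L\in C^\infty(T\mathcal Q)$ put $\theta_{\mathcal L}=\mathrm d\mathcal L\circ S$ and $\Omega_{\mathcal L}=-\mathrm d\theta_{\mathcal L}$; $\mathcal L$ is called a regular Lagrangian if the 2-form $\Omega_{\mathcal L}$ is non-degenerate. Let $\mathcal L$ be a regular Lagrangian on $T\mathcal Q$, and let $\Sigma$ be the dynamics it describes, i.e. a smooth second order vector field on $T\mathcal Q$ ($T\pi(\Sigma_p)=p$ for all $p\in T\mathcal Q$) satisfying the Euler–Lagrange equations $\pounds_\Sigma\theta_{\mathcal L}=\mathrm d\mathcal L$. Let $K=\pounds_\Sigma S$ be the $(1,1)$-tensor field with $K(X)=[\Sigma,SX]-S[\Sigma,X]$ for vector fields $X$ on $T\mathcal Q$, let $L_{\tt v}=\ker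 T\pi$ be the vertical distribution, and let $L_{\tt h}=\ker(K+\mathds 1)$ be the horizontal distribution. Put $$\eta_{\mathcal L}(X,Y)=\Omega_{\mathcal L}(K(X),Y).$$ Then $\eta_{\mathcal L}$ is a smooth pseudo-Riemannian metric of signature $(d,d)$ on $T\mathcal Q$, and the distributions $L_{\tt v}$ and $L_{\tt h}$ are maximally isotropic with respect to $\eta_{\mathcal L}$. Moreover, $(T\mathcal Q,K,\eta_{\mathcal L})$ is an $L_{\tt v}$-para-Kähler manifold with fundamental 2-form $\Omega_{\mathcal L}$, that is: $K$ is a smooth $(1,1)$-tensor field with $K^2=\mathds 1$; its eigendistributions for the eigenvalues $+1$ and $-1$ both have rank $d$; $\eta_{\mathcal L}(KX,KY)=-\eta_{\mathcal L}(X,Y)$; the $+1$-eigendistribution of $K$ is $L_{\tt v}$ and is integrable (closed under Lie brackets of its sections); $\Omega_{\mathcal L}(X,Y)=\eta_{\mathcal L}(KX,Y)$; and $\mathrm d\Omega_{\mathcal L}=0$. -/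

import Mathlib

open scoped Manifold ContDiff
open Set

noncomputable section

section Generic

variable {E : Type*} [NormedAddCommGroup E] [NormedSpace ℝ E]
  {H : Type*} [TopologicalSpace H] (I : ModelWithCorners ℝ E H)
  {M : Type*} [TopologicalSpace M] [ChartedSpace H M] [IsManifold I ∞ M]

/-- `X` is smooth on the set `U`, as a section of the tangent bundle. -/
def SmoothFieldOn (X : Π x : M, TangentSpace I x) (U : Set M) : Prop :=
  ContMDiffOn I I.tangent ∞ (fun x => (⟨x, X x⟩ : TangentBundle I M)) U

/-- The differential of a real function, as a field of covectors. -/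
def mdiff (f : M → ℝ) (x : M) : TangentSpace I x →L[ℝ] ℝ :=
  ((NormedSpace.fromTangentSpace (𝕜 := ℝ) (f x)).toContinuousLinearMap).comp
    (mfderiv I 𝓘(ℝ, ℝ) f x)

/-- A covector field viewed as a differential form of degree one. -/
def oneForm (θ : Π x : M, TangentSpace I x →L[ℝ] ℝ) (x : M) :
    TangentSpace I x [⋀^Fin 1]→L[ℝ] ℝ :=
  ContinuousAlternatingMap.ofSubsingleton ℝ (TangentSpace I x) ℝ (0 : Fin 1) (θ x)

/-- The differential form `α` in the preferred chart at `x`, i.e. its pullback along the inverse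
of that chart. -/
def formInChart {n : ℕ} (α : Π x : M, TangentSpace I x [⋀^Fin n]→L[ℝ] ℝ) (x : M) (y : E) :
    E [⋀^Fin n]→L[ℝ] ℝ :=
  (α ((extChartAt I x).symm y)).compContinuousLinearMap
    (mfderivWithin 𝓘(ℝ, E) I (extChartAt I x).symm (range I) y)

/-- The exterior derivative of a differential form on a manifold. At `x` it is computed in the
preferred chart at `x` and pulled back along that chart. -/
def mextDeriv {n : ℕ} (α : Π x : M, TangentSpace I x [⋀^Fin n]→L[ℝ] ℝ) (x : M) :
    TangentSpace I x [⋀^Fin (n + 1)]→L[ℝ] ℝ :=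
  (extDerivWithin (formInChart I α x) (range I) (extChartAt I x x)).compContinuousLinearMap
    (mfderiv I 𝓘(ℝ, E) (extChartAt I x) x)

/-- The Lie derivative `£_V θ = d (ι_V θ) + ι_V (d θ)` of a covector field `θ`. -/
def lieDerivCovector (V : Π x : M, TangentSpace I x) (θ : Π x : M, TangentSpace I x →L[ℝ] ℝ)
    (x : M) (u : TangentSpace I x) : ℝ :=
  mdiff I (fun y => θ y (V y)) x u + mextDeriv I (oneForm I θ) x ![V x, u]

/-- The endomorphism field `A` in the preferred chart at `x`. -/
def endInChart (A : Π x : M, TangentSpace I x →L[ℝ] TangentSpace I x) (x : M) (y : E) :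
    E →L[ℝ] E :=
  let D := mfderivWithin 𝓘(ℝ, E) I (extChartAt I x).symm (range I) y
  D.inverse.comp ((A ((extChartAt I x).symm y)).comp D)

/-- The Lie derivative `£_V A` of a `(1,1)`-tensor field `A` along a vector field `V`. At `x` it is
given, in the preferred chart at `x`, by the coordinate formula `DA(V) - DV ∘ A + A ∘ DV`.
(Equivalently, `(£_V A) X = [V, A X] - A [V, X]` for vector fields `X`.) -/
def lieDerivEnd (V : Π x : M, TangentSpace I x)
    (A : Π x : M, TangentSpace I x →L[ℝ] TangentSpace I x) (x : M) :
    TangentSpace I x →L[ℝ] TangentSpace I x :=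
  let Vc : E → E :=
    VectorField.mpullbackWithin 𝓘(ℝ, E) I (extChartAt I x).symm V (range I)
  let Ac : E → E →L[ℝ] E := endInChart I A x
  let x₀ : E := extChartAt I x x
  let DV : E →L[ℝ] E := fderivWithin ℝ Vc (range I) x₀
  let DA : E →L[ℝ] E := fderivWithin ℝ Ac (range I) x₀ (Vc x₀)
  let D := mfderiv I 𝓘(ℝ, E) (extChartAt I x) x
  D.inverse.comp ((DA - DV.comp (Ac x₀) + (Ac x₀).comp DV).comp D)

/-- The field `K` of endomorphisms is a smooth `(1,1)`-tensor field: it maps (local) smooth vector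
fields to smooth vector fields. -/
def SmoothEnd (K : Π x : M, TangentSpace I x →L[ℝ] TangentSpace I x) : Prop :=
  ∀ (U : Set M) (X : Π x : M, TangentSpace I x), IsOpen U → SmoothFieldOn I X U →
    SmoothFieldOn I (fun x => K x (X x)) U

/-- The field `η` of bilinear forms is a smooth `(0,2)`-tensor field: it maps pairs of (local)
smooth vector fields to smooth functions. -/
def SmoothBilin (η : Π x : M, LinearMap.BilinForm ℝ (TangentSpace I x)) : Prop :=
  ∀ (U : Set M) (X Y : Π x : M, TangentSpace I x), IsOpen U →
    SmoothFieldOn I X U → SmoothFieldOn I Y U →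
      ContMDiffOn I 𝓘(ℝ, ℝ) ∞ (fun x => η x (X x) (Y x)) U

/-- A distribution is involutive: it is closed under Lie brackets of its (local) sections. -/
def Involutive (D : Π x : M, Submodule ℝ (TangentSpace I x)) : Prop :=
  ∀ (U : Set M) (X Y : Π x : M, TangentSpace I x), IsOpen U →
    SmoothFieldOn I X U → SmoothFieldOn I Y U →
    (∀ x ∈ U, X x ∈ D x) → (∀ x ∈ U, Y x ∈ D x) →
      ∀ x ∈ U, VectorField.mlieBracket I X Y x ∈ D x

/-- The eigendistribution of `K` for the eigenvalue `c`. -/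
def eigenDistribution (K : Π x : M, TangentSpace I x →L[ℝ] TangentSpace I x) (c : ℝ) (x : M) :
    Submodule ℝ (TangentSpace I x) :=
  Module.End.eigenspace (K x).toLinearMap c

/-- `B` vanishes identically on the subspace `W`. -/
def IsIsotropic {V : Type*} [AddCommGroup V] [Module ℝ V] (B : LinearMap.BilinForm ℝ V)
    (W : Submodule ℝ V) : Prop :=
  ∀ u ∈ W, ∀ w ∈ W, B u w = 0

/-- `W` is maximal, with respect to inclusion, among the isotropic subspaces of `B`. -/
def IsMaximallyIsotropic {V : Type*} [AddCommGroup V] [Module ℝ V] (B : LinearMap.BilinForm ℝ V)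
    (W : Submodule ℝ V) : Prop :=
  Maximal (IsIsotropic B) W

/-- `η` is a (smooth, pseudo-Riemannian) metric of signature `(p, q)`. -/
structure IsMetricOfSignature (η : Π x : M, LinearMap.BilinForm ℝ (TangentSpace I x))
    (p q : ℕ) : Prop where
  smooth : SmoothBilin I η
  symm : ∀ x (u w : TangentSpace I x), η x u w = η x w u
  nondegenerate : ∀ x, (η x).Nondegenerate
  positive_index : ∀ x, sigPos (η x).toQuadraticMap = p
  negative_index : ∀ x, sigNeg (η x).toQuadraticMap = q

/-- `K` is an almost para-complex structure on a manifold of dimension `2 d`: `K² = 1` and both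
eigendistributions have rank `d`. -/
structure IsAlmostParaComplex (d : ℕ)
    (K : Π x : M, TangentSpace I x →L[ℝ] TangentSpace I x) : Prop where
  smooth : SmoothEnd I K
  finrank_eq : Module.finrank ℝ E = 2 * d
  involution : ∀ x (u : TangentSpace I x), K x (K x u) = u
  rank_plus : ∀ x, Module.finrank ℝ (eigenDistribution I K 1 x) = d
  rank_minus : ∀ x, Module.finrank ℝ (eigenDistribution I K (-1) x) = d

/-- `(M, K, η)` is an almost para-Hermitian manifold of dimension `2 d`. -/
structure IsAlmostParaHermitian (d : ℕ)
    (K : Π x : M, TangentSpace I x →L[ℝ] TangentSpace I x)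
    (η : Π x : M, LinearMap.BilinForm ℝ (TangentSpace I x)) : Prop where
  paraComplex : IsAlmostParaComplex I d K
  metric : IsMetricOfSignature I η d d
  compatible : ∀ x (u w : TangentSpace I x), η x (K x u) (K x w) = -η x u w

/-- `(M, K, η)` is an `L₊`-para-Kähler manifold of dimension `2 d` with fundamental 2-form `α`:
it is almost para-Hermitian, the eigendistribution `L₊` of `K` for the eigenvalue `1` is
integrable, and the fundamental 2-form `α(X, Y) = η(K X, Y)` is closed. -/
structure IsPlusParaKahler (d : ℕ)
    (K : Π x : M, TangentSpace I x →L[ℝ] TangentSpace I x)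
    (η : Π x : M, LinearMap.BilinForm ℝ (TangentSpace I x))
    (α : Π x : M, TangentSpace I x [⋀^Fin 2]→L[ℝ] ℝ) : Prop where
  paraHermitian : IsAlmostParaHermitian I d K η
  integrable_plus : Involutive I (eigenDistribution I K 1)
  fundamental : ∀ x (u w : TangentSpace I x), α x ![u, w] = η x (K x u) w
  closed : ∀ x, mextDeriv I α x = 0

theorem update_pair_zero {V : Type*} (a b c : V) : Function.update ![a, b] 0 c = ![c, b] := by
  ext i; fin_cases i <;> simp

theorem update_pair_one {V : Type*} (a b c : V) : Function.update ![a, b] 1 c = ![a, c] := by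
  ext i; fin_cases i <;> simp

/-- The bilinear form `(u, w) ↦ α(A u, w)`. -/
def twistedBilin {V : Type*} [AddCommGroup V] [Module ℝ V] [TopologicalSpace V]
    (α : V [⋀^Fin 2]→L[ℝ] ℝ) (A : V →L[ℝ] V) : LinearMap.BilinForm ℝ V :=
  LinearMap.mk₂ ℝ (fun u w => α ![A u, w])
    (fun u u' w => by
      have h := α.map_update_add ![A u, w] 0 (A u) (A u')
      rw [update_pair_zero, update_pair_zero, update_pair_zero] at h
      rw [map_add, h])
    (fun c u w => by
      have h := α.map_update_smul ![A u, w] 0 c (A u)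
      rw [update_pair_zero, update_pair_zero] at h
      rw [map_smul, h])
    (fun u w w' => by
      have h := α.map_update_add ![A u, w] 1 w w'
      rw [update_pair_one, update_pair_one, update_pair_one] at h
      exact h)
    (fun c u w => by
      have h := α.map_update_smul ![A u, w] 1 c w
      rw [update_pair_one, update_pair_one] at h
      exact h)

end Generic

section Lagrangian

variable {E : Type*} [NormedAddCommGroup E] [NormedSpace ℝ E]
  {H : Type*} [TopologicalSpace H] (I : ModelWithCorners ℝ E H)
  {Q : Type*} [TopologicalSpace Q] [ChartedSpace H Q] [IsManifold I ∞ Q]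

/-- The tangent map `Tπ : T_p(TQ) → T_{π(p)}Q` of the bundle projection `π : TQ → Q`. -/
def tangentProj (p : TangentBundle I Q) : TangentSpace I.tangent p →L[ℝ] TangentSpace I p.1 :=
  mfderiv I.tangent I (fun z : TangentBundle I Q => z.1) p

/-- The vertical distribution `L_v = ker Tπ` on `TQ`. -/
def verticalDistribution (p : TangentBundle I Q) : Submodule ℝ (TangentSpace I.tangent p) :=
  (tangentProj I p).ker

/-- The vertical lift `ρ_p : T_{π(p)}Q → T_p(TQ)`: the derivative at `p` of the inclusion of the
fibre `T_{π(p)}Q` into `TQ`. -/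
def verticalLift (p : TangentBundle I Q) : TangentSpace I p.1 →L[ℝ] TangentSpace I.tangent p :=
  mfderiv 𝓘(ℝ, E) I.tangent (fun w : E => (⟨p.1, w⟩ : TangentBundle I Q)) p.2

/-- The vertical endomorphism `S = ρ ∘ Tπ`. -/
def verticalEnd (p : TangentBundle I Q) :
    TangentSpace I.tangent p →L[ℝ] TangentSpace I.tangent p :=
  (verticalLift I p).comp (tangentProj I p)

/-- The Cartan 1-form `θ_L = dL ∘ S`. -/
def cartanForm (L : TangentBundle I Q → ℝ) (p : TangentBundle I Q) :
    TangentSpace I.tangent p →L[ℝ] ℝ :=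
  (mdiff I.tangent L p).comp (verticalEnd I p)

/-- The Lagrangian 2-form `Ω_L = -dθ_L`. -/
def lagrangianForm (L : TangentBundle I Q → ℝ) (p : TangentBundle I Q) :
    TangentSpace I.tangent p [⋀^Fin 2]→L[ℝ] ℝ :=
  -mextDeriv I.tangent (oneForm I.tangent (cartanForm I L)) p

/-- A regular Lagrangian: a smooth function on `TQ` with non-degenerate Lagrangian 2-form. -/
structure IsRegularLagrangian (L : TangentBundle I Q → ℝ) : Prop where
  smooth : ContMDiff I.tangent 𝓘(ℝ, ℝ) ∞ L
  nondegenerate : ∀ (p : TangentBundle I Q) (u : TangentSpace I.tangent p),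
    (∀ w : TangentSpace I.tangent p, lagrangianForm I L p ![u, w] = 0) → u = 0

/-- `Σ` (here `V`) is the dynamics described by `L`: a smooth second order vector field on `TQ`
which satisfies the Euler-Lagrange equations `£_Σ θ_L = dL`. -/
structure IsLagrangianDynamics (L : TangentBundle I Q → ℝ)
    (V : Π p : TangentBundle I Q, TangentSpace I.tangent p) : Prop where
  smooth : SmoothFieldOn I.tangent V univ
  second_order : ∀ p : TangentBundle I Q, tangentProj I p (V p) = p.2
  euler_lagrange : ∀ (p : TangentBundle I Q) (u : TangentSpace I.tangent p),
    lieDerivCovector I.tangent V (cartanForm I L) p u = mdiff I.tangent L p u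

/-- The dynamical almost para-complex structure `K = £_Σ S`. -/
def dynamicalK (V : Π p : TangentBundle I Q, TangentSpace I.tangent p)
    (p : TangentBundle I Q) : TangentSpace I.tangent p →L[ℝ] TangentSpace I.tangent p :=
  lieDerivEnd I.tangent V (verticalEnd I) p

/-- The horizontal distribution `L_h` of a second order vector field: the eigendistribution of
`K = £_Σ S` for the eigenvalue `-1`. -/
def horizontalDistribution (V : Π p : TangentBundle I Q, TangentSpace I.tangent p)
    (p : TangentBundle I Q) : Submodule ℝ (TangentSpace I.tangent p) :=
  eigenDistribution I.tangent (dynamicalK I V) (-1) p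

/-- The tensor field `η_L(X, Y) = Ω_L(K X, Y)`. -/
def lagrangianMetric (L : TangentBundle I Q → ℝ)
    (V : Π p : TangentBundle I Q, TangentSpace I.tangent p) (p : TangentBundle I Q) :
    LinearMap.BilinForm ℝ (TangentSpace I.tangent p) :=
  twistedBilin (lagrangianForm I L p) (dynamicalK I V p)

end Lagrangian

end

/-!
The proof works in the preferred chart of `TQ` at a point `p`, with coordinates `(q, v)` in `E × E`,
and uses that the derivative of this chart at `p` itself is the identity.

In such a chart the vertical endomorphism is the constant `J (a, b) = (0, a)`
(`chartDeriv_verticalEnd`), and a second order field is `V (q, v) = (v, F (q, v))`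
(`fieldInChart_fst_of_second_order`). Hence `K = J ∘ DV - DV ∘ J` is
`(a, b) ↦ (-a, b - ∂F/∂v a)`, which gives at once `K² = 1` and `ker (K - 1) = ker Tπ`
(`dynamicalK_eq_of_second_order`). The invariant formula `K X = [V, S X] - S [V, X]`
(`dynamicalK_eq_mlieBracket`) is the same computation, and it shows that `K` is smooth, because
brackets of smooth fields are smooth.

The analytic core is `Ω (K X, Y) = -Ω (X, K Y)` (`lagrangianForm_dynamicalK_left`). Since `J` is
constant with `J² = 0`, symmetry of the second derivative of `L` gives
`Ω (S X, Y) = -Ω (X, S Y)`; and the Euler-Lagrange equations `£_V θ = dL` give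
`£_V Ω = -d d L = 0`. The Lie derivative of the first identity along `V` is the claim. To have the
Euler-Lagrange equations on a whole neighbourhood of `p` in a single chart, one needs that the
exterior derivative, which is defined at each point by means of the preferred chart there, may be
computed in any other chart (`mextDeriv_eq_extDeriv`); this also gives `dΩ = 0` and the smoothness
of `Ω`.

What remains is linear algebra. Skew-adjointness and `K² = 1` make `η = Ω (K ·, ·)` symmetric, with
`η (K u, K w) = -η (u, w)`. So both eigenspaces of `K` are isotropic and complementary, hence
maximally isotropic (`isMaximallyIsotropic_eigenspace`), and `K` is an isometry from `η` to `-η`,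
so the two indices agree and the signature is neutral (`sigPos_sigNeg_of_antiIsometry`).
-/

/-! ### Lie derivatives of one-forms in a normed space -/

section Calculus

variable {F : Type*} [NormedAddCommGroup F] [NormedSpace ℝ F]

/-- In a normed space, if `£_V θ = dg` then `£_V dθ = 0`. Here `dθ (a, b)` is written as
`Dθ a b - Dθ b a`, and the left-hand side is the coordinate expression of `£_V dθ (a, b)`. -/
theorem lieDeriv_fderiv_antisymm_eq_zero {T : Set F} (hT : IsOpen T) {g : F → ℝ} {θ : F → F →L[ℝ] ℝ}
    {V : F → F} (hg : ContDiffOn ℝ ∞ g T) (hθ : ContDiffOn ℝ ∞ θ T) (hV : ContDiffOn ℝ ∞ V T)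
    (hlie : ∀ y ∈ T, ∀ w, θ y (fderiv ℝ V y w) + fderiv ℝ θ y (V y) w = fderiv ℝ g y w)
    {y : F} (hy : y ∈ T) (a b : F) :
    (fderiv ℝ θ y (fderiv ℝ V y a) b - fderiv ℝ θ y b (fderiv ℝ V y a)) +
      (fderiv ℝ θ y a (fderiv ℝ V y b) - fderiv ℝ θ y (fderiv ℝ V y b) a) +
      (fderiv ℝ (fderiv ℝ θ) y (V y) a b - fderiv ℝ (fderiv ℝ θ) y (V y) b a) = 0 := by
  have hTy : T ∈ nhds y := hT.mem_nhds hy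
  have hg' := hg.contDiffAt hTy
  have hθ' := hθ.contDiffAt hTy
  have hV' := hV.contDiffAt hTy
  have d1 : DifferentiableAt ℝ θ y := hθ'.differentiableAt (by simp)
  have d2 : DifferentiableAt ℝ V y := hV'.differentiableAt (by simp)
  have d3 : DifferentiableAt ℝ (fderiv ℝ θ) y :=
    (hθ'.fderiv_right (m := 1) (by norm_cast)).differentiableAt (by simp)
  have d4 : DifferentiableAt ℝ (fderiv ℝ V) y :=
    (hV'.fderiv_right (m := 1) (by norm_cast)).differentiableAt (by simp)
  have d5 : DifferentiableAt ℝ (fderiv ℝ g) y :=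
    (hg'.fderiv_right (m := 1) (by norm_cast)).differentiableAt (by simp)
  have sθ : IsSymmSndFDerivAt ℝ θ y := hθ'.isSymmSndFDerivAt (by simp; norm_cast)
  have sV : IsSymmSndFDerivAt ℝ V y := hV'.isSymmSndFDerivAt (by simp; norm_cast)
  have sg : IsSymmSndFDerivAt ℝ g y := hg'.isSymmSndFDerivAt (by simp; norm_cast)
  -- the derivative of the identity `hlie` along `u`, for a fixed argument `w`
  have key : ∀ u w : F, θ y (fderiv ℝ (fderiv ℝ V) y u w) + fderiv ℝ θ y u (fderiv ℝ V y w)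
      + (fderiv ℝ θ y (fderiv ℝ V y u) w + fderiv ℝ (fderiv ℝ θ) y u (V y) w)
      = fderiv ℝ (fderiv ℝ g) y u w := by
    intro u w
    have e : (fun z => θ z (fderiv ℝ V z w) + fderiv ℝ θ z (V z) w)
        =ᶠ[nhds y] fun z => fderiv ℝ g z w := by
      filter_upwards [hTy] with z hz using hlie z hz w
    have h := e.fderiv_eq (𝕜 := ℝ)
    have hw : HasFDerivAt (fun _ : F => w) (0 : F →L[ℝ] F) y := hasFDerivAt_const w y
    have h1 := d1.hasFDerivAt.clm_apply (d4.hasFDerivAt.clm_apply hw)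
    have h2 := (d3.hasFDerivAt.clm_apply d2.hasFDerivAt).clm_apply hw
    have h3 := d5.hasFDerivAt.clm_apply hw
    rw [(h1.fun_add h2).fderiv, h3.fderiv] at h
    have h' := congrArg (fun f : F →L[ℝ] ℝ => f u) h
    simp at h'
    linarith
  have k1 := key a b
  have k2 := key b a
  rw [sg.eq a b, sV.eq a b, sθ.eq a (V y)] at k1
  rw [sθ.eq b (V y)] at k2
  linarith

/-- In a chart, `K = £_V J` is skew-adjoint for the exterior derivative of `θ = dL ∘ J` if
`£_V θ = dL`. This is the Lie derivative of the identity which says that `J` is skew-adjoint. -/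
theorem skewAdjoint_lieDeriv_of_eulerLagrange {T : Set F} (hT : IsOpen T) {L : F → ℝ}
    {V : F → F} {J : F →L[ℝ] F} (hJ : ∀ w, J (J w) = 0) (hL : ContDiffOn ℝ ∞ L T)
    (hV : ContDiffOn ℝ ∞ V T) {θ : F → F →L[ℝ] ℝ} (hθ : ∀ y, θ y = (fderiv ℝ L y).comp J)
    (hlie : ∀ y ∈ T, ∀ w, θ y (fderiv ℝ V y w) + fderiv ℝ θ y (V y) w = fderiv ℝ L y w)
    {y : F} (hy : y ∈ T) {K : F →L[ℝ] F} (hK : ∀ w, K w = J (fderiv ℝ V y w) - fderiv ℝ V y (J w))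
    (a b : F) :
    (fderiv ℝ θ y (K a) b - fderiv ℝ θ y b (K a)) +
      (fderiv ℝ θ y a (K b) - fderiv ℝ θ y (K b) a) = 0 := by
  have hdL : ContDiffOn ℝ ∞ (fderiv ℝ L) T := hL.fderiv_of_isOpen hT (by simp)
  have hθ' : ContDiffOn ℝ ∞ θ T := by
    rw [funext hθ]
    exact hdL.clm_comp contDiffOn_const
  have hdθ : ContDiffOn ℝ ∞ (fderiv ℝ θ) T := hθ'.fderiv_of_isOpen hT (by simp)
  -- as `J` is constant, `Dθ u w = D²L u (J w)`
  have dθ : ∀ z ∈ T, ∀ u w, fderiv ℝ θ z u w = fderiv ℝ (fderiv ℝ L) z u (J w) := by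
    intro z hz u w
    have hd : DifferentiableAt ℝ (fderiv ℝ L) z :=
      (hdL.contDiffAt (hT.mem_nhds hz)).differentiableAt (by simp)
    have h := hd.hasFDerivAt.clm_comp (hasFDerivAt_const J z)
    rw [funext hθ, h.fderiv]
    simp
  -- `J` is skew-adjoint for `dθ`, by symmetry of `D²L` and `J² = 0`
  have skew : ∀ z ∈ T, ∀ u w, fderiv ℝ θ z (J u) w - fderiv ℝ θ z w (J u)
      + (fderiv ℝ θ z u (J w) - fderiv ℝ θ z (J w) u) = 0 := by
    intro z hz u w
    have s : IsSymmSndFDerivAt ℝ L z :=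
      (hL.contDiffAt (hT.mem_nhds hz)).isSymmSndFDerivAt (by simp; norm_cast)
    rw [dθ z hz, dθ z hz, dθ z hz, dθ z hz, hJ, hJ, s.eq (J u) (J w)]
    simp
  have hTy : T ∈ nhds y := hT.mem_nhds hy
  have d3 : DifferentiableAt ℝ (fderiv ℝ θ) y := (hdθ.contDiffAt hTy).differentiableAt (by simp)
  have hc : ∀ u : F, HasFDerivAt (fun _ : F => u) (0 : F →L[ℝ] F) y := fun u => hasFDerivAt_const u y
  have D : ∀ u w : F, HasFDerivAt (fun z => fderiv ℝ θ z u w) _ y :=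
    fun u w => (d3.hasFDerivAt.clm_apply (hc u)).clm_apply (hc w)
  -- the derivative of `skew` along `V`
  have skew' : fderiv ℝ (fderiv ℝ θ) y (V y) (J a) b - fderiv ℝ (fderiv ℝ θ) y (V y) b (J a)
      + (fderiv ℝ (fderiv ℝ θ) y (V y) a (J b) - fderiv ℝ (fderiv ℝ θ) y (V y) (J b) a) = 0 := by
    have e : (fun z => fderiv ℝ θ z (J a) b - fderiv ℝ θ z b (J a)
      + (fderiv ℝ θ z a (J b) - fderiv ℝ θ z (J b) a)) =ᶠ[nhds y] fun _ => 0 := by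
      filter_upwards [hTy] with z hz using skew z hz a b
    have h := e.fderiv_eq (𝕜 := ℝ)
    rw [(((D (J a) b).fun_sub (D b (J a))).fun_add ((D a (J b)).fun_sub (D (J b) a))).fderiv] at h
    have h' := congrArg (fun f : F →L[ℝ] ℝ => f (V y)) h
    simpa using h'
  have l1 := lieDeriv_fderiv_antisymm_eq_zero hT hL hθ' hV hlie hy (J a) b
  have l2 := lieDeriv_fderiv_antisymm_eq_zero hT hL hθ' hV hlie hy a (J b)
  have s1 := skew y hy a (fderiv ℝ V y b)
  have s2 := skew y hy (fderiv ℝ V y a) b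
  -- `l1 + l2 - skew'` is the claim, up to moving `J` across `dθ` by `s1` and `s2`
  rw [hK, hK]
  simp only [map_sub, sub_apply]
  linarith

theorem fderiv_fst_apply {G F₁ F₂ : Type*} [NormedAddCommGroup G] [NormedSpace ℝ G]
    [NormedAddCommGroup F₁] [NormedSpace ℝ F₁] [NormedAddCommGroup F₂] [NormedSpace ℝ F₂]
    {f : G → F₁ × F₂} {y : G} (hf : DifferentiableAt ℝ f y) (w : G) :
    (fderiv ℝ f y w).1 = fderiv ℝ (fun z => (f z).1) y w := by
  rw [hf.hasFDerivAt.fst.fderiv]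
  rfl

end Calculus

/-! ### Involutions which are anti-isometries of a bilinear form -/

section Algebra

variable {W : Type*} [AddCommGroup W] [Module ℝ W]

theorem isIsotropic_eigenspace {B : LinearMap.BilinForm ℝ W} {K : W →ₗ[ℝ] W}
    (hB : ∀ u w, B (K u) (K w) = -B u w) {c : ℝ} (hc : c * c = 1) :
    IsIsotropic B (Module.End.eigenspace K c) := by
  intro u hu w hw
  rw [Module.End.mem_eigenspace_iff] at hu hw
  have h := hB u w
  rw [hu, hw] at h
  simp only [map_smul, LinearMap.smul_apply, smul_eq_mul, ← mul_assoc, hc] at h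
  linarith

/-- For a non-degenerate form, an isotropic subspace which has an isotropic complement (here, the
other eigenspace of the involution `K`) is maximal: a vector of a larger isotropic subspace has
its component in the complement orthogonal to everything. -/
theorem isMaximallyIsotropic_eigenspace {B : LinearMap.BilinForm ℝ W} {K : W →ₗ[ℝ] W}
    (hB : ∀ u w, B (K u) (K w) = -B u w) (hK : ∀ u, K (K u) = u) (hnd : ∀ u, (∀ w, B u w = 0) → u = 0)
    {c : ℝ} (hc : c * c = 1) :
    IsMaximallyIsotropic B (Module.End.eigenspace K c) := by
  refine ⟨isIsotropic_eigenspace hB hc, fun N hN hle w hw => ?_⟩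
  -- `u + c K u` and `u - c K u` are twice the components of `u` in the two eigenspaces
  have hplus : ∀ u, u + c • K u ∈ Module.End.eigenspace K c := by
    intro u
    rw [Module.End.mem_eigenspace_iff, map_add, map_smul, hK, smul_add, smul_smul, hc, one_smul,
      add_comm]
  have hminus : ∀ u, u - c • K u ∈ Module.End.eigenspace K (-c) := by
    intro u
    rw [Module.End.mem_eigenspace_iff, map_sub, map_smul, hK, smul_sub, smul_smul, neg_mul, hc]
    module
  have hcc : -c * -c = 1 := by rw [neg_mul_neg, hc]
  have hb : w - c • K w ∈ N := by
    have : w - c • K w = (2 : ℝ) • w - (w + c • K w) := by module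
    rw [this]
    exact N.sub_mem (N.smul_mem _ hw) (hle (hplus w))
  have hzero : w - c • K w = 0 := by
    refine hnd _ fun v => ?_
    have hv : v = (1 / 2 : ℝ) • (v + c • K v) + (1 / 2 : ℝ) • (v - c • K v) := by module
    rw [hv, map_add, map_smul, map_smul, hN _ hb _ (hle (hplus v)),
      isIsotropic_eigenspace hB hcc _ (hminus w) _ (hminus v)]
    simp
  rw [Module.End.mem_eigenspace_iff]
  have h := sub_eq_zero.1 hzero
  conv_rhs => rw [h]
  rw [smul_smul, hc, one_smul]

theorem finrank_eigenspace_neg_one [FiniteDimensional ℝ W] {K : W →ₗ[ℝ] W} (hK : ∀ u, K (K u) = u)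
    {d : ℕ} (hd : Module.finrank ℝ W = 2 * d)
    (h1 : Module.finrank ℝ (Module.End.eigenspace K 1) = d) :
    Module.finrank ℝ (Module.End.eigenspace K (-1)) = d := by
  have hrange : Module.End.eigenspace K (-1) = LinearMap.range (K - 1) := by
    ext u
    rw [Module.End.mem_eigenspace_iff, LinearMap.mem_range]
    constructor
    · intro h
      refine ⟨(-1 / 2 : ℝ) • u, ?_⟩
      rw [LinearMap.sub_apply, map_smul, h, Module.End.one_apply]
      module
    · rintro ⟨w, rfl⟩
      simp [hK]
  have hker : Module.End.eigenspace K 1 = LinearMap.ker (K - 1) := by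
    ext u
    rw [Module.End.mem_eigenspace_iff, LinearMap.mem_ker, LinearMap.sub_apply, sub_eq_zero,
      one_smul, Module.End.one_apply]
  have := LinearMap.finrank_range_add_finrank_ker (K - 1)
  rw [hrange]
  rw [hker] at h1
  omega

/-- A non-degenerate symmetric form `B` has neutral signature if it is isometric to `-B`: its
positive and negative indices agree, and they add up to the dimension. -/
theorem sigPos_sigNeg_of_antiIsometry [FiniteDimensional ℝ W] {B : LinearMap.BilinForm ℝ W}
    {K : W →ₗ[ℝ] W} (hB : ∀ u w, B (K u) (K w) = -B u w) (hK : ∀ u, K (K u) = u)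
    (hsymm : ∀ u w, B u w = B w u) (hnd : ∀ u, (∀ w, B u w = 0) → u = 0)
    {d : ℕ} (hd : Module.finrank ℝ W = 2 * d) :
    sigPos B.toQuadraticMap = d ∧ sigNeg B.toQuadraticMap = d := by
  have heq : sigPos B.toQuadraticMap = sigNeg B.toQuadraticMap := by
    refine QuadraticMap.Equivalent.sigPos_eq
      (Q' := -B.toQuadraticMap) ⟨⟨LinearEquiv.ofLinearMap K K (LinearMap.ext hK) (LinearMap.ext hK), ?_⟩⟩
    intro u
    simp [hB]
  have hrad : B.toQuadraticMap.radical = ⊥ := by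
    rw [eq_bot_iff]
    intro u hu
    rw [QuadraticMap.mem_radical_iff'] at hu
    refine (Submodule.mem_bot ℝ).2 (hnd u fun w => ?_)
    have h := hu.2 w
    have h0 := hu.1
    simp only [LinearMap.BilinMap.toQuadraticMap_apply, map_add, LinearMap.add_apply] at h h0
    have := hsymm u w
    linarith
  have hsum := QuadraticForm.sigPos_add_sigNeg_add_radical (Q := B.toQuadraticMap)
  rw [hrad, finrank_bot] at hsum
  omega

end Algebra

/-! ### Derivatives of charts and chart independence of the exterior derivative -/

section Charts

variable {E : Type*} [NormedAddCommGroup E] [NormedSpace ℝ E]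
  {H : Type*} [TopologicalSpace H] (I : ModelWithCorners ℝ E H)
  {M : Type*} [TopologicalSpace M] [ChartedSpace H M]

/-- The derivative at `z` of the preferred chart at `x`, with values in the model space. -/
noncomputable def chartDeriv (x z : M) : TangentSpace I z →L[ℝ] E :=
  mfderiv I 𝓘(ℝ, E) (extChartAt I x) z

/-- The derivative at `y` of the inverse of the preferred chart at `x`. -/
noncomputable def chartSymmDeriv (x : M) (y : E) : E →L[ℝ] TangentSpace I ((extChartAt I x).symm y) :=
  mfderivWithin 𝓘(ℝ, E) I (extChartAt I x).symm (range I) y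

/-- The components of the vector field `X` in the preferred chart at `x`. -/
noncomputable def fieldInChart (X : Π x : M, TangentSpace I x) (x : M) (y : E) : E :=
  chartDeriv I x ((extChartAt I x).symm y) (X ((extChartAt I x).symm y))

variable {I}

theorem exists_eq_extChartAt_symm {x z : M} (hz : z ∈ (extChartAt I x).source) :
    ∃ y ∈ (extChartAt I x).target, z = (extChartAt I x).symm y :=
  ⟨extChartAt I x z, (extChartAt I x).map_source hz, ((extChartAt I x).left_inv hz).symm⟩

variable [IsManifold I ∞ M]

theorem isManifold_one_of_infty : IsManifold I 1 M :=
  IsManifold.of_le (n := ∞) (by norm_cast)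

theorem chartDeriv_chartSymmDeriv {x : M} {y : E} (hy : y ∈ (extChartAt I x).target) (w : E) :
    chartDeriv I x ((extChartAt I x).symm y) (chartSymmDeriv I x y w) = w := by
  have : IsManifold I 1 M := isManifold_one_of_infty
  exact congrArg (fun f : E →L[ℝ] E => f w)
    (mfderiv_extChartAt_comp_mfderivWithin_extChartAt_symm (I := I) hy)

theorem chartSymmDeriv_chartDeriv {x : M} {y : E} (hy : y ∈ (extChartAt I x).target)
    (u : TangentSpace I ((extChartAt I x).symm y)) :
    chartSymmDeriv I x y (chartDeriv I x ((extChartAt I x).symm y) u) = u := by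
  have : IsManifold I 1 M := isManifold_one_of_infty
  exact congrArg (fun f : E →L[ℝ] E => f u)
    (mfderivWithin_extChartAt_symm_comp_mfderiv_extChartAt (I := I) hy)

/-- The derivative of the preferred chart at its centre is the identity of `E`, which is the
underlying space of every tangent space. -/
theorem chartDeriv_self (x : M) (u : TangentSpace I x) : chartDeriv I x x u = u := by
  have : IsManifold I 1 M := isManifold_one_of_infty
  exact congrArg (fun f : E →L[ℝ] E => f u) (mfderiv_extChartAt_self (I := I) (x := x))

theorem chartDeriv_injective {x z : M} (hz : z ∈ (extChartAt I x).source) :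
    Function.Injective (chartDeriv I x z) := by
  obtain ⟨y, hy, rfl⟩ := exists_eq_extChartAt_symm hz
  exact Function.LeftInverse.injective (chartSymmDeriv_chartDeriv hy)

theorem chartSymmDeriv_inverse_apply {x : M} {y : E} (hy : y ∈ (extChartAt I x).target)
    (u : TangentSpace I ((extChartAt I x).symm y)) :
    (chartSymmDeriv I x y).inverse u = chartDeriv I x ((extChartAt I x).symm y) u := by
  rw [ContinuousLinearMap.inverse_eq (g := chartDeriv I x ((extChartAt I x).symm y))]
  · ext u
    exact chartSymmDeriv_chartDeriv hy u
  · ext u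
    exact chartDeriv_chartSymmDeriv hy u

theorem mpullbackWithin_extChartAt_symm (X : Π x : M, TangentSpace I x) {x : M} {y : E}
    (hy : y ∈ (extChartAt I x).target) :
    VectorField.mpullbackWithin 𝓘(ℝ, E) I (extChartAt I x).symm X (range I) y =
      fieldInChart I X x y :=
  chartSymmDeriv_inverse_apply hy _

/-- The form in a chart recovers the form, by evaluation at the images of tangent vectors. -/
theorem formInChart_extChartAt_chartDeriv {n : ℕ}
    (α : Π x : M, TangentSpace I x [⋀^Fin n]→L[ℝ] ℝ) {x z : M}
    (hz : z ∈ (extChartAt I x).source) (u : Fin n → TangentSpace I z) :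
    formInChart I α x (extChartAt I x z) (fun i => chartDeriv I x z (u i)) = α z u := by
  obtain ⟨y, hy, rfl⟩ := exists_eq_extChartAt_symm hz
  rw [(extChartAt I x).right_inv hy]
  exact congrArg (α _) (funext fun i => chartSymmDeriv_chartDeriv hy (u i))

variable [I.Boundaryless]

theorem fderiv_extChartAt_comp_symm {x z : M} {y : E} (hy : y ∈ (extChartAt I z).target)
    (hx : (extChartAt I z).symm y ∈ (extChartAt I x).source) (w : E) :
    fderiv ℝ (extChartAt I x ∘ (extChartAt I z).symm) y w =
      chartDeriv I x ((extChartAt I z).symm y) (chartSymmDeriv I z y w) := by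
  have : IsManifold I 1 M := isManifold_one_of_infty
  have h1 : MDifferentiableAt I 𝓘(ℝ, E) (extChartAt I x) ((extChartAt I z).symm y) :=
    mdifferentiableAt_extChartAt (by rwa [extChartAt_source] at hx)
  have h2 := mdifferentiableWithinAt_extChartAt_symm (I := I) hy
  rw [I.range_eq_univ, mdifferentiableWithinAt_univ] at h2
  have h := mfderiv_comp (I'' := 𝓘(ℝ, E)) y h1 h2
  rw [mfderiv_eq_fderiv] at h
  rw [h, chartSymmDeriv, I.range_eq_univ, mfderivWithin_univ]
  rfl

/-- The exterior derivative at `z`, which is defined by means of the preferred chart at `z`, may be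
computed in any other preferred chart around `z`, because the exterior derivative on `E` commutes
with pullback along the transition map. -/
theorem mextDeriv_eq_extDeriv {n : ℕ} (α : Π x : M, TangentSpace I x [⋀^Fin n]→L[ℝ] ℝ) {x : M}
    {z : M} (hz : z ∈ (extChartAt I x).source)
    (hα : DifferentiableAt ℝ (formInChart I α x) (extChartAt I x z))
    (u : Fin (n + 1) → TangentSpace I z) :
    mextDeriv I α z u =
      extDeriv (formInChart I α x) (extChartAt I x z) (fun i => chartDeriv I x z (u i)) := by
  have : IsManifold I 1 M := isManifold_one_of_infty
  set φ : E → E := extChartAt I x ∘ (extChartAt I z).symm with hφ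
  have hzz : extChartAt I z z ∈ (extChartAt I z).target := mem_extChartAt_target z
  have hinv : (extChartAt I z).symm (extChartAt I z z) = z := extChartAt_to_inv z
  have hφz : φ (extChartAt I z z) = extChartAt I x z := by rw [hφ, Function.comp_apply, hinv]
  have hev : formInChart I α z =ᶠ[nhds (extChartAt I z z)]
      fun y => (formInChart I α x (φ y)).compContinuousLinearMap (fderiv ℝ φ y) := by
    have h1 : ∀ᶠ y in nhds (extChartAt I z z), y ∈ (extChartAt I z).target :=
      extChartAt_target_mem_nhds z
    have h2 : ∀ᶠ y in nhds (extChartAt I z z),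
        (extChartAt I z).symm y ∈ (extChartAt I x).source :=
      (continuousAt_extChartAt_symm z).eventually (by
        rw [hinv]; exact (isOpen_extChartAt_source x).mem_nhds hz)
    filter_upwards [h1, h2] with y hy hy'
    ext v
    have e : (fun i => fderiv ℝ φ y (v i)) =
        fun i => chartDeriv I x ((extChartAt I z).symm y) (chartSymmDeriv I z y (v i)) :=
      funext fun i => fderiv_extChartAt_comp_symm hy hy' (v i)
    change _ = formInChart I α x (extChartAt I x ((extChartAt I z).symm y))
      (fun i => fderiv ℝ φ y (v i))
    rw [e, formInChart_extChartAt_chartDeriv α hy']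
    rfl
  have hcd : ContDiffAt ℝ ∞ φ (extChartAt I z z) := by
    have h := contDiffWithinAt_ext_coord_change (I := I) (n := ∞) x z (y := extChartAt I z z)
      (by simp [PartialEquiv.trans_source] at hz ⊢; exact hz)
    rw [I.range_eq_univ, contDiffWithinAt_univ] at h
    exact h
  have hpull := extDeriv_pullback (f := φ) (x := extChartAt I z z) (r := ∞)
    (show DifferentiableAt ℝ (formInChart I α x) (φ (extChartAt I z z)) by rw [hφz]; exact hα) hcd
    (by rw [minSmoothness_of_isRCLikeNormedField]; norm_cast)
  have hL : mextDeriv I α z u = extDeriv (formInChart I α z) (extChartAt I z z) u := by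
    unfold mextDeriv
    rw [I.range_eq_univ, extDerivWithin_univ]
    exact congrArg (extDeriv (formInChart I α z) (extChartAt I z z))
      (funext fun i => chartDeriv_self z (u i))
  rw [hL, hev.extDeriv_eq, hpull, hφz]
  refine congrArg (extDeriv (formInChart I α x) (extChartAt I x z)) (funext fun i => ?_)
  refine (fderiv_extChartAt_comp_symm hzz (by rwa [hinv]) (u i)).trans ?_
  -- the inverse of the preferred chart at `z` has the identity as its derivative at the centre
  have hs : chartSymmDeriv I z (extChartAt I z z) (u i) = u i := by
    have h := mfderivWithin_range_extChartAt_symm (I := I) (x := z)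
    exact congrArg (fun f : E →L[ℝ] E => f (u i)) h
  rw [hs, hinv]

end Charts

/-! ### Vector fields, brackets and Lie derivatives in a chart -/

section ChartFields

variable {E : Type*} [NormedAddCommGroup E] [NormedSpace ℝ E]
  {H : Type*} [TopologicalSpace H] {I : ModelWithCorners ℝ E H}
  {M : Type*} [TopologicalSpace M] [ChartedSpace H M] [IsManifold I ∞ M]

/-- A vector field is smooth at a point iff its components in a chart around the point are. -/
theorem contMDiffAt_field_iff {X : Π x : M, TangentSpace I x} {x z : M}
    (hz : z ∈ (extChartAt I x).source) :
    ContMDiffAt I I.tangent ∞ (fun y => (⟨y, X y⟩ : TangentBundle I M)) z ↔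
      ContMDiffAt I 𝓘(ℝ, E) ∞ (fun y => chartDeriv I x y (X y)) z := by
  have hone : IsManifold I 1 M := isManifold_one_of_infty
  rw [extChartAt_source] at hz
  have h := (trivializationAt E (TangentSpace I) x).contMDiffAt_section_iff (IB := I) (n := ∞)
    (s := X) (x₀ := z) (by exact hz)
  refine h.trans (Filter.EventuallyEq.contMDiffAt_iff ?_)
  filter_upwards [(chartAt H x).open_source.mem_nhds hz] with y hy
  have h2 := TangentBundle.continuousLinearMapAt_trivializationAt (I := I) hy
  have h3 := (trivializationAt E (TangentSpace I) x).continuousLinearMapAt_apply_of_mem (R := ℝ)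
    (b := y) (by exact hy) (X y)
  rw [← h3, h2]
  rfl

theorem SmoothFieldOn.contMDiffAt_chartDeriv {X : Π x : M, TangentSpace I x} {U : Set M}
    (hX : SmoothFieldOn I X U) (hU : IsOpen U) {x z : M} (hz : z ∈ (extChartAt I x).source)
    (hzU : z ∈ U) : ContMDiffAt I 𝓘(ℝ, E) ∞ (fun y => chartDeriv I x y (X y)) z :=
  (contMDiffAt_field_iff hz).1 (hX.contMDiffAt (hU.mem_nhds hzU))

variable [I.Boundaryless]

theorem contMDiffAt_extChartAt_symm' {x : M} {y : E} (hy : y ∈ (extChartAt I x).target) :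
    ContMDiffAt 𝓘(ℝ, E) I ∞ (extChartAt I x).symm y :=
  (contMDiffOn_extChartAt_symm x).contMDiffAt ((isOpen_extChartAt_target x).mem_nhds hy)

theorem contDiffAt_comp_extChartAt_symm {G : Type*} [NormedAddCommGroup G] [NormedSpace ℝ G]
    {f : M → G} {x : M} {y : E} (hy : y ∈ (extChartAt I x).target)
    (hf : ContMDiffAt I 𝓘(ℝ, G) ∞ f ((extChartAt I x).symm y)) :
    ContDiffAt ℝ ∞ (fun y => f ((extChartAt I x).symm y)) y :=
  contMDiffAt_iff_contDiffAt.1 (hf.comp y (contMDiffAt_extChartAt_symm' hy))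

theorem SmoothFieldOn.contDiffAt_fieldInChart {X : Π x : M, TangentSpace I x} {U : Set M}
    (hX : SmoothFieldOn I X U) (hU : IsOpen U) {x : M} {y : E}
    (hy : y ∈ (extChartAt I x).target) (hyU : (extChartAt I x).symm y ∈ U) :
    ContDiffAt ℝ ∞ (fieldInChart I X x) y :=
  contDiffAt_comp_extChartAt_symm hy
    (hX.contMDiffAt_chartDeriv hU ((extChartAt I x).map_target hy) hyU)

/-- The differential of a function, computed in a chart. -/
theorem mdiff_eq_fderiv {f : M → ℝ} {x z : M} (hz : z ∈ (extChartAt I x).source)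
    (hf : MDifferentiableAt I 𝓘(ℝ, ℝ) f z) (u : TangentSpace I z) :
    mdiff I f z u =
      fderiv ℝ (fun y => f ((extChartAt I x).symm y)) (extChartAt I x z) (chartDeriv I x z u) := by
  have hone : IsManifold I 1 M := isManifold_one_of_infty
  obtain ⟨y, hy, rfl⟩ := exists_eq_extChartAt_symm hz
  rw [(extChartAt I x).right_inv hy]
  have h2 := mdifferentiableWithinAt_extChartAt_symm (I := I) hy
  rw [I.range_eq_univ, mdifferentiableWithinAt_univ] at h2
  have h := mfderiv_comp (I'' := 𝓘(ℝ, ℝ)) y hf h2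
  rw [mfderiv_eq_fderiv] at h
  have hs := chartSymmDeriv_chartDeriv hy u
  rw [chartSymmDeriv, I.range_eq_univ, mfderivWithin_univ] at hs
  change _ = fderiv ℝ (f ∘ (extChartAt I x).symm) y _
  rw [h]
  exact congrArg (fun w => (mfderiv I 𝓘(ℝ, ℝ) f ((extChartAt I x).symm y)) w) hs.symm

theorem mpullbackWithin_eventuallyEq (X : Π x : M, TangentSpace I x) (x : M) :
    VectorField.mpullbackWithin 𝓘(ℝ, E) I (extChartAt I x).symm X (range I)
      =ᶠ[nhds (extChartAt I x x)] fieldInChart I X x := by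
  filter_upwards [extChartAt_target_mem_nhds (I := I) x] with y hy
  exact mpullbackWithin_extChartAt_symm X hy

omit [I.Boundaryless] in
theorem mfderiv_extChartAt_inverse_apply (x : M) (w : E) :
    (mfderiv I 𝓘(ℝ, E) (extChartAt I x) x).inverse w = w := by
  have hone : IsManifold I 1 M := isManifold_one_of_infty
  rw [mfderiv_extChartAt_self]
  exact congrArg (fun f : E →L[ℝ] E => f w) ContinuousLinearMap.inverse_id

/-- The Lie bracket at the centre of a chart is the Lie bracket of the components. -/
theorem mlieBracket_eq_lieBracket (X Y : Π x : M, TangentSpace I x) (x : M) :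
    VectorField.mlieBracket I X Y x =
      VectorField.lieBracket ℝ (fieldInChart I X x) (fieldInChart I Y x) (extChartAt I x x) := by
  -- stated for functions on `E`, so that the tangent spaces of `E` do not get in the way
  have aux : ∀ (X' Y' : E → E) (s : Set E), s = univ →
      X' =ᶠ[nhds (extChartAt I x x)] fieldInChart I X x →
      Y' =ᶠ[nhds (extChartAt I x x)] fieldInChart I Y x →
      VectorField.lieBracketWithin ℝ X' Y' s (extChartAt I x x) =
        VectorField.lieBracket ℝ (fieldInChart I X x) (fieldInChart I Y x) (extChartAt I x x) := by
    rintro X' Y' s rfl hX hY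
    rw [VectorField.lieBracketWithin_univ]
    exact hX.lieBracket_vectorField_eq hY
  refine (mfderiv_extChartAt_inverse_apply x _).trans (aux _ _ _ ?_
    (mpullbackWithin_eventuallyEq X x) (mpullbackWithin_eventuallyEq Y x))
  rw [I.range_eq_univ, preimage_univ, univ_inter]

/-- The Lie derivative of an endomorphism field whose matrix in the chart is the constant `J`. -/
theorem lieDerivEnd_eq_of_const {V : Π x : M, TangentSpace I x}
    {A : Π x : M, TangentSpace I x →L[ℝ] TangentSpace I x} {x : M} {J : E →L[ℝ] E}
    (hA : ∀ z ∈ (extChartAt I x).source, ∀ u, chartDeriv I x z (A z u) = J (chartDeriv I x z u))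
    (u : TangentSpace I x) :
    lieDerivEnd I V A x u =
      J (fderiv ℝ (fieldInChart I V x) (extChartAt I x x) u) -
        fderiv ℝ (fieldInChart I V x) (extChartAt I x x) (J u) := by
  have hAc : endInChart I A x =ᶠ[nhds (extChartAt I x x)] fun _ => J := by
    filter_upwards [extChartAt_target_mem_nhds (I := I) x] with y hy
    ext w
    have h := hA _ ((extChartAt I x).map_target hy) (chartSymmDeriv I x y w)
    rw [chartDeriv_chartSymmDeriv hy] at h
    rw [← h]
    exact chartSymmDeriv_inverse_apply hy _
  have aux : ∀ (D : E →L[ℝ] E) (Vc : E → E) (Ac : E → E →L[ℝ] E) (s : Set E) (x₀ u : E),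
      D = ContinuousLinearMap.id ℝ E → s = univ →
      Vc =ᶠ[nhds x₀] fieldInChart I V x → (Ac =ᶠ[nhds x₀] fun _ => J) →
      (D.inverse.comp ((fderivWithin ℝ Ac s x₀ (Vc x₀) - (fderivWithin ℝ Vc s x₀).comp (Ac x₀) +
          (Ac x₀).comp (fderivWithin ℝ Vc s x₀)).comp D)) u =
        J (fderiv ℝ (fieldInChart I V x) x₀ u) - fderiv ℝ (fieldInChart I V x) x₀ (J u) := by
    rintro D Vc Ac s x₀ u rfl rfl hV hA
    rw [fderivWithin_univ, fderivWithin_univ, hV.fderiv_eq, hA.fderiv_eq, hA.self_of_nhds]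
    simp
    abel
  have hone : IsManifold I 1 M := isManifold_one_of_infty
  exact aux _ _ _ _ _ u mfderiv_extChartAt_self I.range_eq_univ (mpullbackWithin_eventuallyEq V x)
    hAc

end ChartFields

/-! ### Charts of the tangent bundle -/

section TangentCharts

variable {E : Type*} [NormedAddCommGroup E] [NormedSpace ℝ E]
  {H : Type*} [TopologicalSpace H] {I : ModelWithCorners ℝ E H}
  {Q : Type*} [TopologicalSpace Q] [ChartedSpace H Q] [IsManifold I ∞ Q]

theorem mem_extChartAt_tangent_source {p z : TangentBundle I Q} :
    z ∈ (extChartAt I.tangent p).source ↔ z.1 ∈ (extChartAt I p.1).source := by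
  rw [extChartAt_source, extChartAt_source]
  exact TangentBundle.mem_chart_source_iff z p

/-- The chart of `TQ` induced by a chart of `Q` has the components `(q, v)`, where `v` is the
image of the tangent vector under the derivative of the chart of `Q`. -/
theorem extChartAt_tangent_apply {p z : TangentBundle I Q}
    (hz : z ∈ (extChartAt I.tangent p).source) :
    extChartAt I.tangent p z = (extChartAt I p.1 z.1, chartDeriv I p.1 z.1 z.2) := by
  have hone : IsManifold I 1 Q := isManifold_one_of_infty
  rw [mem_extChartAt_tangent_source, extChartAt_source] at hz
  have h2 := TangentBundle.continuousLinearMapAt_trivializationAt (I := I) hz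
  have h3 := (trivializationAt E (TangentSpace I) p.1).continuousLinearMapAt_apply_of_mem (R := ℝ)
    (b := z.1) (by exact hz) z.2
  refine Prod.ext rfl ?_
  refine Eq.trans ?_ (h3.symm.trans (congrArg (fun f : E →L[ℝ] E => f z.2) h2))
  rfl

theorem mdifferentiableAt_extChartAt_of_mem {x z : Q} (hz : z ∈ (extChartAt I x).source) :
    MDifferentiableAt I 𝓘(ℝ, E) (extChartAt I x) z := by
  have hone : IsManifold I 1 Q := isManifold_one_of_infty
  exact mdifferentiableAt_extChartAt (by rwa [extChartAt_source] at hz)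

/-- The `q`-component of a vector tangent to `TQ` is its projection to `TQ`: the first component of
the chart of `TQ` is the chart of `Q` after the bundle projection. -/
theorem chartDeriv_tangent_fst {p z : TangentBundle I Q}
    (hz : z ∈ (extChartAt I.tangent p).source) (u : TangentSpace I.tangent z) :
    (chartDeriv I.tangent p z u).1 = chartDeriv I p.1 z.1 (tangentProj I z u) := by
  have h1 : MDifferentiableAt I 𝓘(ℝ, E) (extChartAt I p.1) z.1 :=
    mdifferentiableAt_extChartAt_of_mem (mem_extChartAt_tangent_source.1 hz)
  have h2 : MDifferentiableAt I.tangent I (fun z : TangentBundle I Q => z.1) z :=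
    (Bundle.contMDiffAt_proj (TangentSpace I) (n := ∞)).mdifferentiableAt (by simp)
  have h3 : MDifferentiableAt I.tangent 𝓘(ℝ, E × E) (extChartAt I.tangent p) z :=
    mdifferentiableAt_extChartAt_of_mem hz
  have e1 := mfderiv_comp (I'' := 𝓘(ℝ, E)) z h1 h2
  have e2 := mfderiv_comp (I'' := 𝓘(ℝ, E)) z
    (ContinuousLinearMap.fst ℝ E E).differentiableAt.mdifferentiableAt h3
  rw [mfderiv_eq_fderiv, ContinuousLinearMap.fderiv] at e2
  have e3 : ((ContinuousLinearMap.fst ℝ E E) ∘ (extChartAt I.tangent p)) =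
      extChartAt I p.1 ∘ fun z : TangentBundle I Q => z.1 := rfl
  rw [e3] at e2
  exact congrArg (fun f : E × E →L[ℝ] E => f u) (e2.symm.trans e1)

theorem contMDiff_fiberInclusion (x : Q) :
    ContMDiff 𝓘(ℝ, E) I.tangent ∞ (fun w : E => (⟨x, w⟩ : TangentBundle I Q)) := by
  have hone : IsManifold I 1 Q := isManifold_one_of_infty
  intro w
  rw [Bundle.contMDiffAt_totalSpace]
  refine ⟨contMDiffAt_const, ?_⟩
  have h : ∀ D : E →L[ℝ] E, ContMDiffAt 𝓘(ℝ, E) 𝓘(ℝ, E) ∞ (fun w => D w) w :=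
    fun D => D.contDiff.contDiffAt.contMDiffAt
  refine (h (chartDeriv I x x)).congr_of_eventuallyEq (Filter.Eventually.of_forall fun w' => ?_)
  exact congrArg Prod.snd (extChartAt_tangent_apply (p := ⟨x, w⟩) (z := ⟨x, w'⟩)
    (mem_extChartAt_tangent_source.2 (mem_extChartAt_source x)))

/-- On a fibre, the chart of `TQ` is linear in `v` with constant `q`. -/
theorem chartDeriv_tangent_verticalLift {p z : TangentBundle I Q}
    (hz : z ∈ (extChartAt I.tangent p).source) (w : TangentSpace I z.1) :
    chartDeriv I.tangent p z (verticalLift I z w) = (0, chartDeriv I p.1 z.1 w) := by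
  obtain ⟨x, (v : E)⟩ := z
  have h1 : MDifferentiableAt I.tangent 𝓘(ℝ, E × E) (extChartAt I.tangent p) ⟨x, v⟩ :=
    mdifferentiableAt_extChartAt_of_mem hz
  have h2 : MDifferentiableAt 𝓘(ℝ, E) I.tangent (fun w : E => (⟨x, w⟩ : TangentBundle I Q)) v :=
    (contMDiff_fiberInclusion x v).mdifferentiableAt (by simp)
  have e1 := mfderiv_comp (I'' := 𝓘(ℝ, E × E)) v h1 h2
  have e2 : ∀ w : E, extChartAt I.tangent p (⟨x, w⟩ : TangentBundle I Q) =
      (extChartAt I p.1 x, chartDeriv I p.1 x w) := fun w =>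
    extChartAt_tangent_apply (p := p) (z := ⟨x, w⟩)
      (mem_extChartAt_tangent_source.2 (mem_extChartAt_tangent_source.1 hz))
  have e3 : ∀ (D : E →L[ℝ] E) (c : E) (f : E → E × E) (y : E), (∀ w, f w = (c, D w)) →
      mfderiv 𝓘(ℝ, E) 𝓘(ℝ, E × E) f y = (0 : E →L[ℝ] E).prod D := by
    intro D c f y hf
    have h : HasFDerivAt f ((0 : E →L[ℝ] E).prod D) y := by
      rw [funext hf]
      exact (hasFDerivAt_const _ _).prodMk D.hasFDerivAt
    rw [mfderiv_eq_fderiv, h.fderiv]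
  have e4 := e1.symm.trans (e3 _ _ _ v e2)
  exact congrArg (fun f : E →L[ℝ] E × E => f w) e4

variable (E) in
/-- The vertical endomorphism `∂/∂v ⊗ dq` in the coordinates `(q, v)`. -/
noncomputable def modelVerticalEnd : E × E →L[ℝ] E × E :=
  (ContinuousLinearMap.inr ℝ E E).comp (ContinuousLinearMap.fst ℝ E E)

@[simp]
theorem modelVerticalEnd_apply (w : E × E) : modelVerticalEnd E w = (0, w.1) := rfl

/-- The vertical endomorphism has the same constant matrix in every chart of `TQ`. -/
theorem chartDeriv_verticalEnd {p z : TangentBundle I Q}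
    (hz : z ∈ (extChartAt I.tangent p).source) (u : TangentSpace I.tangent z) :
    chartDeriv I.tangent p z (verticalEnd I z u) =
      modelVerticalEnd E (chartDeriv I.tangent p z u) := by
  rw [modelVerticalEnd_apply, chartDeriv_tangent_fst hz u]
  exact chartDeriv_tangent_verticalLift hz _

theorem mem_verticalDistribution_iff {p z : TangentBundle I Q}
    (hz : z ∈ (extChartAt I.tangent p).source) (u : TangentSpace I.tangent z) :
    u ∈ verticalDistribution I z ↔ (chartDeriv I.tangent p z u).1 = 0 := by
  rw [chartDeriv_tangent_fst hz, verticalDistribution]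
  refine LinearMap.mem_ker.trans ⟨fun h => ?_, fun h => ?_⟩
  · exact (congrArg (chartDeriv I p.1 z.1) h).trans (map_zero _)
  · exact chartDeriv_injective (mem_extChartAt_tangent_source.1 hz) (h.trans (map_zero _).symm)

end TangentCharts

/-! ### The Cartan form and the Lagrangian form in a chart -/

section LagrangianCharts

theorem extDeriv_ofSubsingleton_apply {F : Type*} [NormedAddCommGroup F] [NormedSpace ℝ F]
    {θ : F → F →L[ℝ] ℝ} {y : F} (hθ : DifferentiableAt ℝ θ y) (v : Fin 2 → F) :
    extDeriv (fun y => ContinuousAlternatingMap.ofSubsingleton ℝ F ℝ (0 : Fin 1) (θ y)) y v =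
      fderiv ℝ θ y (v 0) (v 1) - fderiv ℝ θ y (v 1) (v 0) := by
  have hd : DifferentiableAt ℝ
      (fun y => ContinuousAlternatingMap.ofSubsingleton ℝ F ℝ (0 : Fin 1) (θ y)) y :=
    (ContinuousAlternatingMap.ofSubsingletonLIE (𝕜 := ℝ) (E := F) (F := ℝ) (0 : Fin 1)).differentiable.differentiableAt.comp
      y hθ
  have h : ∀ a b : F, fderiv ℝ (fun y => θ y a) y b = fderiv ℝ θ y b a := by
    intro a b
    rw [(hθ.hasFDerivAt.clm_apply (hasFDerivAt_const a y)).fderiv]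
    simp
  rw [extDeriv_apply hd, Fin.sum_univ_two]
  have e0 : (0 : Fin 2).removeNth v 0 = v 1 := rfl
  have e1 : (1 : Fin 2).removeNth v 0 = v 0 := rfl
  simp only [ContinuousAlternatingMap.ofSubsingleton_apply_apply, e0, e1, h]
  simp [sub_eq_add_neg]

variable {E : Type*} [NormedAddCommGroup E] [NormedSpace ℝ E]
  {H : Type*} [TopologicalSpace H] {I : ModelWithCorners ℝ E H}
  {Q : Type*} [TopologicalSpace Q] [ChartedSpace H Q] [IsManifold I ∞ Q]

variable (I) in
/-- The components `∂L/∂v dq` of the Cartan 1-form in the preferred chart at `p`. -/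
noncomputable def cartanFormInChart (L : TangentBundle I Q → ℝ) (p : TangentBundle I Q) (y : E × E) :
    E × E →L[ℝ] ℝ :=
  (fderiv ℝ (fun y => L ((extChartAt I.tangent p).symm y)) y).comp (modelVerticalEnd E)

variable [I.Boundaryless] {L : TangentBundle I Q → ℝ} {p : TangentBundle I Q}

theorem contDiffOn_lagrangian_inChart (hL : ContMDiff I.tangent 𝓘(ℝ, ℝ) ∞ L)
    (p : TangentBundle I Q) :
    ContDiffOn ℝ ∞ (fun y => L ((extChartAt I.tangent p).symm y))
      (extChartAt I.tangent p).target :=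
  fun _ hy => (contDiffAt_comp_extChartAt_symm hy (hL _)).contDiffWithinAt

theorem contDiffOn_cartanFormInChart (hL : ContMDiff I.tangent 𝓘(ℝ, ℝ) ∞ L)
    (p : TangentBundle I Q) :
    ContDiffOn ℝ ∞ (cartanFormInChart I L p) (extChartAt I.tangent p).target :=
  ((contDiffOn_lagrangian_inChart hL p).fderiv_of_isOpen (isOpen_extChartAt_target p)
    (by simp)).clm_comp contDiffOn_const

theorem differentiableAt_cartanFormInChart (hL : ContMDiff I.tangent 𝓘(ℝ, ℝ) ∞ L) {y : E × E}
    (hy : y ∈ (extChartAt I.tangent p).target) :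
    DifferentiableAt ℝ (cartanFormInChart I L p) y :=
  ((contDiffOn_cartanFormInChart hL p).contDiffAt
    ((isOpen_extChartAt_target p).mem_nhds hy)).differentiableAt (by simp)

theorem cartanForm_eq_cartanFormInChart (hL : ContMDiff I.tangent 𝓘(ℝ, ℝ) ∞ L)
    {z : TangentBundle I Q} (hz : z ∈ (extChartAt I.tangent p).source)
    (u : TangentSpace I.tangent z) :
    cartanForm I L z u =
      cartanFormInChart I L p (extChartAt I.tangent p z) (chartDeriv I.tangent p z u) := by
  refine (mdiff_eq_fderiv hz ((hL z).mdifferentiableAt (by simp)) (verticalEnd I z u)).trans ?_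
  rw [chartDeriv_verticalEnd hz]
  rfl

theorem formInChart_cartanForm (hL : ContMDiff I.tangent 𝓘(ℝ, ℝ) ∞ L) {y : E × E}
    (hy : y ∈ (extChartAt I.tangent p).target) :
    formInChart I.tangent (oneForm I.tangent (cartanForm I L)) p y =
      ContinuousAlternatingMap.ofSubsingleton ℝ (E × E) ℝ (0 : Fin 1)
        (cartanFormInChart I L p y) := by
  ext v
  have h := cartanForm_eq_cartanFormInChart hL ((extChartAt I.tangent p).map_target hy)
    (chartSymmDeriv I.tangent p y (v 0))
  rw [chartDeriv_chartSymmDeriv hy, (extChartAt I.tangent p).right_inv hy] at h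
  exact h

theorem formInChart_cartanForm_eventuallyEq (hL : ContMDiff I.tangent 𝓘(ℝ, ℝ) ∞ L) {y : E × E}
    (hy : y ∈ (extChartAt I.tangent p).target) :
    formInChart I.tangent (oneForm I.tangent (cartanForm I L)) p =ᶠ[nhds y]
      fun y => ContinuousAlternatingMap.ofSubsingleton ℝ (E × E) ℝ (0 : Fin 1)
        (cartanFormInChart I L p y) := by
  filter_upwards [(isOpen_extChartAt_target p).mem_nhds hy] with y' hy'
  exact formInChart_cartanForm hL hy'

theorem contDiffAt_formInChart_cartanForm (hL : ContMDiff I.tangent 𝓘(ℝ, ℝ) ∞ L) {y : E × E}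
    (hy : y ∈ (extChartAt I.tangent p).target) :
    ContDiffAt ℝ ∞ (formInChart I.tangent (oneForm I.tangent (cartanForm I L)) p) y :=
  ((ContinuousAlternatingMap.ofSubsingletonLIE (𝕜 := ℝ) (E := E × E) (F := ℝ) (0 : Fin 1)).contDiff.contDiffAt.comp y
    ((contDiffOn_cartanFormInChart hL p).contDiffAt
      ((isOpen_extChartAt_target p).mem_nhds hy))).congr_of_eventuallyEq
    (formInChart_cartanForm_eventuallyEq hL hy)

/-- The exterior derivative of the Cartan 1-form at any point of a chart, in that chart. -/
theorem mextDeriv_cartanForm (hL : ContMDiff I.tangent 𝓘(ℝ, ℝ) ∞ L)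
    {z : TangentBundle I Q} (hz : z ∈ (extChartAt I.tangent p).source)
    (u : Fin 2 → TangentSpace I.tangent z) :
    mextDeriv I.tangent (oneForm I.tangent (cartanForm I L)) z u =
      fderiv ℝ (cartanFormInChart I L p) (extChartAt I.tangent p z)
          (chartDeriv I.tangent p z (u 0)) (chartDeriv I.tangent p z (u 1)) -
        fderiv ℝ (cartanFormInChart I L p) (extChartAt I.tangent p z)
          (chartDeriv I.tangent p z (u 1)) (chartDeriv I.tangent p z (u 0)) := by
  have hy := (extChartAt I.tangent p).map_source hz
  rw [mextDeriv_eq_extDeriv _ hz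
    ((contDiffAt_formInChart_cartanForm hL hy).differentiableAt (by simp)),
    (formInChart_cartanForm_eventuallyEq hL hy).extDeriv_eq,
    extDeriv_ofSubsingleton_apply (differentiableAt_cartanFormInChart hL hy)]

theorem lagrangianForm_apply (hL : ContMDiff I.tangent 𝓘(ℝ, ℝ) ∞ L)
    {z : TangentBundle I Q} (hz : z ∈ (extChartAt I.tangent p).source)
    (u w : TangentSpace I.tangent z) :
    lagrangianForm I L z ![u, w] =
      -(fderiv ℝ (cartanFormInChart I L p) (extChartAt I.tangent p z)
          (chartDeriv I.tangent p z u) (chartDeriv I.tangent p z w) -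
        fderiv ℝ (cartanFormInChart I L p) (extChartAt I.tangent p z)
          (chartDeriv I.tangent p z w) (chartDeriv I.tangent p z u)) :=
  congrArg Neg.neg (mextDeriv_cartanForm hL hz ![u, w])

/-- `Ω_L` is exact in every chart, hence closed. -/
theorem mextDeriv_lagrangianForm (hL : ContMDiff I.tangent 𝓘(ℝ, ℝ) ∞ L) (p : TangentBundle I Q) :
    mextDeriv I.tangent (lagrangianForm I L) p = 0 := by
  set τ := formInChart I.tangent (oneForm I.tangent (cartanForm I L)) p
  have hp := mem_extChartAt_target (I := I.tangent) p
  have hev : formInChart I.tangent (lagrangianForm I L) p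
      =ᶠ[nhds (extChartAt I.tangent p p)] (-1 : ℝ) • extDeriv τ := by
    filter_upwards [(isOpen_extChartAt_target (I := I.tangent) p).mem_nhds hp] with y hy
    ext v
    have hz := (extChartAt I.tangent p).map_target hy
    have hr := (extChartAt I.tangent p).right_inv hy
    have h := mextDeriv_eq_extDeriv (oneForm I.tangent (cartanForm I L)) hz
      (by rw [hr]; exact (contDiffAt_formInChart_cartanForm hL hy).differentiableAt (by simp))
      (fun i => chartSymmDeriv I.tangent p y (v i))
    simp only [chartDeriv_chartSymmDeriv hy, hr] at h
    rw [Pi.smul_apply, ContinuousAlternatingMap.smul_apply, neg_one_smul]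
    exact congrArg Neg.neg h
  have hzero : extDeriv (formInChart I.tangent (lagrangianForm I L) p)
      (extChartAt I.tangent p p) = 0 := by
    rw [hev.extDeriv_eq, extDeriv_smul, extDeriv_extDeriv_apply
      (contDiffAt_formInChart_cartanForm hL hp)
      (by rw [minSmoothness_of_isRCLikeNormedField]; norm_cast), smul_zero]
  unfold mextDeriv
  rw [I.tangent.range_eq_univ, extDerivWithin_univ, hzero]
  rfl

/-- The 2-form `Ω_L` is smooth. -/
theorem contMDiffOn_lagrangianForm (hL : ContMDiff I.tangent 𝓘(ℝ, ℝ) ∞ L)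
    {U : Set (TangentBundle I Q)} (hU : IsOpen U)
    {X Y : Π p : TangentBundle I Q, TangentSpace I.tangent p}
    (hX : SmoothFieldOn I.tangent X U) (hY : SmoothFieldOn I.tangent Y U) :
    ContMDiffOn I.tangent 𝓘(ℝ, ℝ) ∞ (fun z => lagrangianForm I L z ![X z, Y z]) U := by
  intro p hp
  refine ContMDiffAt.contMDiffWithinAt ?_
  have hps := mem_extChartAt_source (I := I.tangent) p
  have hX' := hX.contMDiffAt_chartDeriv hU hps hp
  have hY' := hY.contMDiffAt_chartDeriv hU hps hp
  have hc : ContMDiffAt I.tangent 𝓘(ℝ, E × E →L[ℝ] E × E →L[ℝ] ℝ) ∞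
      (fun z => fderiv ℝ (cartanFormInChart I L p) (extChartAt I.tangent p z)) p := by
    have h1 : ContDiffAt ℝ ∞ (fderiv ℝ (cartanFormInChart I L p)) (extChartAt I.tangent p p) :=
      ((contDiffOn_cartanFormInChart hL p).fderiv_of_isOpen (isOpen_extChartAt_target p)
        (by simp)).contDiffAt ((isOpen_extChartAt_target p).mem_nhds (mem_extChartAt_target p))
    exact h1.contMDiffAt.comp p contMDiffAt_extChartAt
  refine ContMDiffAt.congr_of_eventuallyEq
    (((hc.clm_apply hX').clm_apply hY').sub ((hc.clm_apply hY').clm_apply hX')).neg ?_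
  filter_upwards [(isOpen_extChartAt_source (I := I.tangent) p).mem_nhds hps] with z hz
  exact lagrangianForm_apply hL hz (X z) (Y z)

/-- The Euler-Lagrange equations in a chart. With the differential of `θ(V)` expanded, the terms
`Dθ w V` in `d (ι_V θ)` and in `ι_V dθ` cancel. -/
theorem eulerLagrange_inChart (hL : ContMDiff I.tangent 𝓘(ℝ, ℝ) ∞ L)
    {V : Π p : TangentBundle I Q, TangentSpace I.tangent p} (hV : IsLagrangianDynamics I L V)
    {y : E × E} (hy : y ∈ (extChartAt I.tangent p).target) (w : E × E) :
    cartanFormInChart I L p y (fderiv ℝ (fieldInChart I.tangent V p) y w) +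
        fderiv ℝ (cartanFormInChart I L p) y (fieldInChart I.tangent V p y) w =
      fderiv ℝ (fun y => L ((extChartAt I.tangent p).symm y)) y w := by
  have hz := (extChartAt I.tangent p).map_target hy
  have hr := (extChartAt I.tangent p).right_inv hy
  have hθ := differentiableAt_cartanFormInChart hL hy
  have hVy : DifferentiableAt ℝ (fieldInChart I.tangent V p) y :=
    (hV.smooth.contDiffAt_fieldInChart isOpen_univ hy (mem_univ _)).differentiableAt (by simp)
  have hθV : ∀ z ∈ (extChartAt I.tangent p).source, cartanForm I L z (V z) =
      cartanFormInChart I L p (extChartAt I.tangent p z) (chartDeriv I.tangent p z (V z)) :=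
    fun z hz => cartanForm_eq_cartanFormInChart hL hz (V z)
  have hsmooth : MDifferentiableAt I.tangent 𝓘(ℝ, ℝ) (fun z => cartanForm I L z (V z))
      ((extChartAt I.tangent p).symm y) := by
    have h1 : ContMDiffAt I.tangent 𝓘(ℝ, E × E →L[ℝ] ℝ) ∞
        (fun z => cartanFormInChart I L p (extChartAt I.tangent p z))
        ((extChartAt I.tangent p).symm y) := by
      have h2 : ContDiffAt ℝ ∞ (cartanFormInChart I L p)
          (extChartAt I.tangent p ((extChartAt I.tangent p).symm y)) := by
        rw [hr]
        exact (contDiffOn_cartanFormInChart hL p).contDiffAt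
          ((isOpen_extChartAt_target p).mem_nhds hy)
      exact h2.contMDiffAt.comp _
        (contMDiffAt_extChartAt' (by rwa [extChartAt_source] at hz))
    refine ((h1.clm_apply (hV.smooth.contMDiffAt_chartDeriv isOpen_univ hz
      (mem_univ _))).congr_of_eventuallyEq ?_).mdifferentiableAt (by simp)
    filter_upwards [(isOpen_extChartAt_source (I := I.tangent) p).mem_nhds hz] with z hz
    exact hθV z hz
  have hEL := hV.euler_lagrange ((extChartAt I.tangent p).symm y)
    (chartSymmDeriv I.tangent p y w)
  unfold lieDerivCovector at hEL
  rw [mdiff_eq_fderiv hz hsmooth, mdiff_eq_fderiv hz ((hL _).mdifferentiableAt (by simp)),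
    mextDeriv_cartanForm hL hz] at hEL
  simp only [Matrix.cons_val_zero, Matrix.cons_val_one, chartDeriv_chartSymmDeriv hy, hr] at hEL
  have hev : (fun y => cartanForm I L ((extChartAt I.tangent p).symm y)
      (V ((extChartAt I.tangent p).symm y))) =ᶠ[nhds y]
      fun y => cartanFormInChart I L p y (fieldInChart I.tangent V p y) := by
    filter_upwards [(isOpen_extChartAt_target (I := I.tangent) p).mem_nhds hy] with y' hy'
    have h := hθV _ ((extChartAt I.tangent p).map_target hy')
    rw [(extChartAt I.tangent p).right_inv hy'] at h
    exact h
  rw [hev.fderiv_eq, (hθ.hasFDerivAt.clm_apply hVy.hasFDerivAt).fderiv] at hEL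
  simp only [add_apply, ContinuousLinearMap.comp_apply, ContinuousLinearMap.flip_apply] at hEL
  have hf : fieldInChart I.tangent V p y = chartDeriv I.tangent p ((extChartAt I.tangent p).symm y)
    (V ((extChartAt I.tangent p).symm y)) := rfl
  rw [← hf] at hEL
  linarith

end LagrangianCharts

/-! ### The tensor field `K` of a second order vector field -/

section Dynamics

variable {E : Type*} [NormedAddCommGroup E] [NormedSpace ℝ E]
  {H : Type*} [TopologicalSpace H] {I : ModelWithCorners ℝ E H}
  {Q : Type*} [TopologicalSpace Q] [ChartedSpace H Q] [IsManifold I ∞ Q]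

theorem mem_verticalDistribution_iff_fst {p : TangentBundle I Q} (u : TangentSpace I.tangent p) :
    u ∈ verticalDistribution I p ↔ Prod.fst (α := E) (β := E) u = 0 := by
  rw [mem_verticalDistribution_iff (mem_extChartAt_source p), chartDeriv_self]

theorem verticalEnd_eq_modelVerticalEnd (p : TangentBundle I Q) (u : TangentSpace I.tangent p) :
    verticalEnd I p u = modelVerticalEnd E u := by
  have h := chartDeriv_verticalEnd (mem_extChartAt_source p) u
  rwa [chartDeriv_self, chartDeriv_self] at h

/-- A second order vector field has the components `(v, F(q, v))` in a chart. -/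
theorem fieldInChart_fst_of_second_order {V : Π p : TangentBundle I Q, TangentSpace I.tangent p}
    (hV : ∀ p : TangentBundle I Q, tangentProj I p (V p) = p.2) {p : TangentBundle I Q} {y : E × E}
    (hy : y ∈ (extChartAt I.tangent p).target) : (fieldInChart I.tangent V p y).1 = y.2 := by
  have hz := (extChartAt I.tangent p).map_target hy
  have h := extChartAt_tangent_apply hz
  rw [(extChartAt I.tangent p).right_inv hy] at h
  have h2 := chartDeriv_tangent_fst hz (V ((extChartAt I.tangent p).symm y))
  rw [hV] at h2
  exact h2.trans (congrArg Prod.snd h).symm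

variable [I.Boundaryless]

/-- The vertical distribution of `TQ` is involutive. -/
theorem involutive_verticalDistribution :
    Involutive I.tangent (verticalDistribution (I := I) (Q := Q)) := by
  intro U X Y hU hX hY hXv hYv p hp
  have hpt := mem_extChartAt_target (I := I.tangent) p
  have hpU : (extChartAt I.tangent p).symm (extChartAt I.tangent p p) ∈ U := by
    rwa [extChartAt_to_inv]
  -- the `q`-components of vertical fields vanish identically in the chart
  have key : ∀ Z : Π p : TangentBundle I Q, TangentSpace I.tangent p, SmoothFieldOn I.tangent Z U →
      (∀ x ∈ U, Z x ∈ verticalDistribution I x) → ∀ w : E × E,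
      (fderiv ℝ (fieldInChart I.tangent Z p) (extChartAt I.tangent p p) w).1 = 0 := by
    intro Z hZ hZv w
    have hev : (fun y => (fieldInChart I.tangent Z p y).1)
        =ᶠ[nhds (extChartAt I.tangent p p)] fun _ => 0 := by
      filter_upwards [extChartAt_target_mem_nhds (I := I.tangent) p,
        (continuousAt_extChartAt_symm p).preimage_mem_nhds (hU.mem_nhds hpU)] with y hy hyU
      exact (mem_verticalDistribution_iff ((extChartAt I.tangent p).map_target hy) _).1
        (hZv _ hyU)
    rw [fderiv_fst_apply ((hZ.contDiffAt_fieldInChart hU hpt hpU).differentiableAt (by simp)),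
      hev.fderiv_eq]
    simp
  rw [mem_verticalDistribution_iff_fst, mlieBracket_eq_lieBracket]
  refine (Prod.fst_sub _ _).trans ?_
  rw [key Y hY hYv, key X hX hXv, sub_zero]

variable {V : Π p : TangentBundle I Q, TangentSpace I.tangent p}

/-- The matrix of `K` at the centre of the chart, where `S` has the constant matrix `J`. -/
theorem dynamicalK_apply (p : TangentBundle I Q) (u : TangentSpace I.tangent p) :
    dynamicalK I V p u =
      modelVerticalEnd E (fderiv ℝ (fieldInChart I.tangent V p) (extChartAt I.tangent p p) u) -
        fderiv ℝ (fieldInChart I.tangent V p) (extChartAt I.tangent p p) (modelVerticalEnd E u) :=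
  lieDerivEnd_eq_of_const (fun _ hz u => chartDeriv_verticalEnd hz u) u

/-- In a chart, `K` is the matrix `(a, b) ↦ (-a, b - ∂F/∂v a)`, where `∂F/∂v` is the derivative of
the acceleration along the fibre. -/
theorem dynamicalK_eq_of_second_order (hV : SmoothFieldOn I.tangent V univ)
    (hV2 : ∀ p : TangentBundle I Q, tangentProj I p (V p) = p.2) (p : TangentBundle I Q) :
    ∃ Γ : E →L[ℝ] E, ∀ u : E × E, dynamicalK I V p u = ((-u.1, u.2 - Γ u.1) : E × E) := by
  have hpt := mem_extChartAt_target (I := I.tangent) p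
  have hd : DifferentiableAt ℝ (fieldInChart I.tangent V p) (extChartAt I.tangent p p) :=
    (hV.contDiffAt_fieldInChart isOpen_univ hpt (mem_univ _)).differentiableAt (by simp)
  have hfst : ∀ w : E × E,
      (fderiv ℝ (fieldInChart I.tangent V p) (extChartAt I.tangent p p) w).1 = w.2 := by
    intro w
    have hev : (fun y => (fieldInChart I.tangent V p y).1)
        =ᶠ[nhds (extChartAt I.tangent p p)] fun y => y.2 := by
      filter_upwards [extChartAt_target_mem_nhds (I := I.tangent) p] with y hy
      exact fieldInChart_fst_of_second_order hV2 hy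
    rw [fderiv_fst_apply hd, hev.fderiv_eq, fderiv_snd]
    rfl
  refine ⟨(ContinuousLinearMap.snd ℝ E E).comp
    ((fderiv ℝ (fieldInChart I.tangent V p) (extChartAt I.tangent p p)).comp
      (ContinuousLinearMap.inr ℝ E E)), fun u => ?_⟩
  refine (dynamicalK_apply p u).trans ?_
  rw [modelVerticalEnd_apply, modelVerticalEnd_apply, hfst]
  refine Prod.ext ?_ ?_
  · exact (congrArg (fun t => (0 : E) - t) (hfst (0, u.1))).trans (zero_sub _)
  · simp

omit [I.Boundaryless] in
theorem smoothFieldOn_verticalEnd {X : Π p : TangentBundle I Q, TangentSpace I.tangent p}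
    {U : Set (TangentBundle I Q)} (hU : IsOpen U) (hX : SmoothFieldOn I.tangent X U) :
    SmoothFieldOn I.tangent (fun z => verticalEnd I z (X z)) U := by
  intro p hp
  have hps := mem_extChartAt_source (I := I.tangent) p
  refine ContMDiffAt.contMDiffWithinAt ((contMDiffAt_field_iff hps).2 ?_)
  have h := (modelVerticalEnd E).contDiff.contDiffAt.contMDiffAt.comp p
    (hX.contMDiffAt_chartDeriv hU hps hp)
  refine h.congr_of_eventuallyEq ?_
  filter_upwards [(isOpen_extChartAt_source (I := I.tangent) p).mem_nhds hps] with z hz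
  exact chartDeriv_verticalEnd hz (X z)

/-- The invariant formula `K(X) = [V, S X] - S [V, X]`. -/
theorem dynamicalK_eq_mlieBracket {U : Set (TangentBundle I Q)}
    {X : Π p : TangentBundle I Q, TangentSpace I.tangent p} (hU : IsOpen U)
    (hX : SmoothFieldOn I.tangent X U) {p : TangentBundle I Q} (hp : p ∈ U) :
    dynamicalK I V p (X p) =
      VectorField.mlieBracket I.tangent V (fun z => verticalEnd I z (X z)) p
        - verticalEnd I p (VectorField.mlieBracket I.tangent V X p) := by
  have hpt := mem_extChartAt_target (I := I.tangent) p
  have hinv := extChartAt_to_inv (I := I.tangent) p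
  have hXd : DifferentiableAt ℝ (fieldInChart I.tangent X p) (extChartAt I.tangent p p) :=
    (hX.contDiffAt_fieldInChart hU hpt (by rwa [hinv])).differentiableAt (by simp)
  have hXp : fieldInChart I.tangent X p (extChartAt I.tangent p p) = X p := by
    have h : ∀ z, z = p → chartDeriv I.tangent p z (X z) = X p := by
      rintro z rfl
      exact chartDeriv_self z (X z)
    exact h _ hinv
  have hSX : fieldInChart I.tangent (fun z => verticalEnd I z (X z)) p
      =ᶠ[nhds (extChartAt I.tangent p p)]
        fun y => modelVerticalEnd E (fieldInChart I.tangent X p y) := by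
    filter_upwards [extChartAt_target_mem_nhds (I := I.tangent) p] with y hy
    exact chartDeriv_verticalEnd ((extChartAt I.tangent p).map_target hy) _
  have h1 : VectorField.mlieBracket I.tangent V (fun z => verticalEnd I z (X z)) p =
      modelVerticalEnd E (fderiv ℝ (fieldInChart I.tangent X p) (extChartAt I.tangent p p)
        (fieldInChart I.tangent V p (extChartAt I.tangent p p))) -
      fderiv ℝ (fieldInChart I.tangent V p) (extChartAt I.tangent p p)
        (modelVerticalEnd E (X p)) := by
    have hcomp : fderiv ℝ (fun y => modelVerticalEnd E (fieldInChart I.tangent X p y))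
        (extChartAt I.tangent p p) = (modelVerticalEnd E).comp
          (fderiv ℝ (fieldInChart I.tangent X p) (extChartAt I.tangent p p)) :=
      ((modelVerticalEnd E).hasFDerivAt.comp _ hXd.hasFDerivAt).fderiv
    have hSXp : fieldInChart I.tangent (fun z => verticalEnd I z (X z)) p (extChartAt I.tangent p p)
        = modelVerticalEnd E (X p) := hSX.self_of_nhds.trans (congrArg (modelVerticalEnd E) hXp)
    rw [mlieBracket_eq_lieBracket, VectorField.lieBracket, hSX.fderiv_eq, hSXp, hcomp]
    rfl
  rw [h1, verticalEnd_eq_modelVerticalEnd, mlieBracket_eq_lieBracket, VectorField.lieBracket, hXp,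
    dynamicalK_apply, map_sub]
  exact (sub_sub_sub_cancel_left _ _ _).symm

/-- `K` is smooth, because of the bracket formula: the definition of `K` refers to a different chart
at each point. -/
theorem smoothEnd_dynamicalK [CompleteSpace E] (hV : SmoothFieldOn I.tangent V univ) :
    SmoothEnd I.tangent (dynamicalK (Q := Q) I V) := by
  intro U X hU hX p hp
  have hps := mem_extChartAt_source (I := I.tangent) p
  have hb : ∀ Y : Π p : TangentBundle I Q, TangentSpace I.tangent p, SmoothFieldOn I.tangent Y U →
      SmoothFieldOn I.tangent (VectorField.mlieBracket I.tangent V Y) U := by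
    intro Y hY z hz
    have : IsManifold I.tangent (((⊤ : ℕ∞) : WithTop ℕ∞) + 1) (TangentBundle I Q) :=
      inferInstanceAs (IsManifold I.tangent ∞ (TangentBundle I Q))
    have : IsManifold I.tangent (minSmoothness ℝ 2) (TangentBundle I Q) := by
      rw [minSmoothness_of_isRCLikeNormedField]
      exact IsManifold.of_le (n := ∞) (by norm_cast)
    exact (ContMDiffAt.mlieBracket_vectorField (n := ⊤) (m := ⊤)
      (hV.contMDiffAt Filter.univ_mem) (hY.contMDiffAt (hU.mem_nhds hz))
      (by rw [minSmoothness_of_isRCLikeNormedField]; rfl)).contMDiffWithinAt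
  have h1 := (hb _ (smoothFieldOn_verticalEnd hU hX)).contMDiffAt_chartDeriv hU hps hp
  have h2 := (smoothFieldOn_verticalEnd hU (hb _ hX)).contMDiffAt_chartDeriv hU hps hp
  refine ContMDiffAt.contMDiffWithinAt ((contMDiffAt_field_iff hps).2 ?_)
  refine (h1.sub h2).congr_of_eventuallyEq ?_
  filter_upwards [hU.mem_nhds hp] with z hz
  exact (congrArg (chartDeriv I.tangent p z) (dynamicalK_eq_mlieBracket hU hX hz)).trans
    (map_sub _ _ _)

/-- `Ω_L(K u, w) = -Ω_L(u, K w)`: the Lie derivative of `Ω_L(S u, w) = -Ω_L(u, S w)` along the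
dynamics, which preserves `Ω_L`. -/
theorem lagrangianForm_dynamicalK_left {L : TangentBundle I Q → ℝ}
    (hL : ContMDiff I.tangent 𝓘(ℝ, ℝ) ∞ L) (hV : IsLagrangianDynamics I L V)
    (p : TangentBundle I Q) (u w : TangentSpace I.tangent p) :
    lagrangianForm I L p ![dynamicalK I V p u, w] =
      -lagrangianForm I L p ![u, dynamicalK I V p w] := by
  have hps := mem_extChartAt_source (I := I.tangent) p
  have hVc : ContDiffOn ℝ ∞ (fieldInChart I.tangent V p) (extChartAt I.tangent p).target :=
    fun y hy => (hV.smooth.contDiffAt_fieldInChart isOpen_univ hy (mem_univ _)).contDiffWithinAt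
  have h := skewAdjoint_lieDeriv_of_eulerLagrange (isOpen_extChartAt_target p)
    (J := modelVerticalEnd E) (θ := cartanFormInChart I L p) (K := dynamicalK I V p)
    (fun w => by simp) (contDiffOn_lagrangian_inChart hL p) hVc (fun _ => rfl)
    (fun y hy w => eulerLagrange_inChart hL hV hy w) (mem_extChartAt_target p)
    (fun w => dynamicalK_apply p w) u w
  rw [lagrangianForm_apply hL hps, lagrangianForm_apply hL hps]
  simp only [chartDeriv_self]
  have aux : ∀ a b c d : ℝ, a - b + (c - d) = 0 → -(a - b) = - -(c - d) := by
    intro a b c d h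
    linarith
  exact aux _ _ _ _ h

end Dynamics

/-! ### The metric of a regular Lagrangian -/

section FiniteDimensional

variable {E : Type*} [NormedAddCommGroup E] [NormedSpace ℝ E]
  {H : Type*} [TopologicalSpace H] {I : ModelWithCorners ℝ E H} [I.Boundaryless]
  {Q : Type*} [TopologicalSpace Q] [ChartedSpace H Q] [IsManifold I ∞ Q]
  {V : Π p : TangentBundle I Q, TangentSpace I.tangent p} {L : TangentBundle I Q → ℝ}

theorem dynamicalK_dynamicalK (hV : IsLagrangianDynamics I L V) (p : TangentBundle I Q)
    (u : TangentSpace I.tangent p) : dynamicalK I V p (dynamicalK I V p u) = u := by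
  obtain ⟨Γ, hΓ⟩ := dynamicalK_eq_of_second_order hV.smooth hV.second_order p
  have aux : ∀ (K : E × E → E × E), (∀ u, K u = (-u.1, u.2 - Γ u.1)) → ∀ u, K (K u) = u := by
    intro K hK u
    rw [hK, hK]
    simp
  exact aux _ hΓ u

theorem eigenDistribution_dynamicalK_one (hV : IsLagrangianDynamics I L V)
    (p : TangentBundle I Q) :
    eigenDistribution I.tangent (dynamicalK I V) 1 p = verticalDistribution I p := by
  obtain ⟨Γ, hΓ⟩ := dynamicalK_eq_of_second_order hV.smooth hV.second_order p
  have aux : ∀ u : E × E, ((-u.1, u.2 - Γ u.1) : E × E) = u ↔ u.1 = 0 := by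
    intro u
    refine ⟨fun h => ?_, fun h => ?_⟩
    · have h1 : -u.1 = u.1 := congrArg Prod.fst h
      have h2 : (2 : ℝ) • u.1 = 0 := by
        rw [two_smul]
        nth_rewrite 1 [← h1]
        exact neg_add_cancel _
      exact (smul_eq_zero.1 h2).resolve_left two_ne_zero
    · exact Prod.ext (by simp [h]) (by simp [h])
  ext u
  rw [mem_verticalDistribution_iff_fst]
  refine Module.End.mem_eigenspace_iff.trans ?_
  rw [one_smul]
  exact Iff.trans ⟨fun h => (hΓ u).symm.trans h, fun h => (hΓ u).trans h⟩ (aux u)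

omit [I.Boundaryless] in
theorem finrank_verticalDistribution (p : TangentBundle I Q) :
    Module.finrank ℝ (verticalDistribution I p) = Module.finrank ℝ E := by
  have aux : ∀ N : Submodule ℝ (E × E), (∀ u, u ∈ N ↔ u.1 = 0) →
      Module.finrank ℝ N = Module.finrank ℝ E := by
    intro N hN
    have h : N = LinearMap.range (LinearMap.inr ℝ E E) := by
      rw [LinearMap.range_inr]
      exact Submodule.ext hN
    rw [h]
    exact LinearMap.finrank_range_of_inj LinearMap.inr_injective
  exact aux (verticalDistribution I p) mem_verticalDistribution_iff_fst

omit [I.Boundaryless] in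
theorem lagrangianMetric_apply (p : TangentBundle I Q) (u w : TangentSpace I.tangent p) :
    lagrangianMetric I L V p u w = lagrangianForm I L p ![dynamicalK I V p u, w] := rfl

omit [I.Boundaryless] in
theorem lagrangianForm_swap (p : TangentBundle I Q) (u w : TangentSpace I.tangent p) :
    lagrangianForm I L p ![u, w] = -lagrangianForm I L p ![w, u] := by
  have h := (lagrangianForm I L p).map_swap ![w, u] (i := 0) (j := 1) (by simp)
  refine Eq.trans (congrArg (lagrangianForm I L p) ?_) h
  ext i
  fin_cases i <;> rfl

theorem lagrangianMetric_dynamicalK_dynamicalK (hL : IsRegularLagrangian I L)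
    (hV : IsLagrangianDynamics I L V) (p : TangentBundle I Q) (u w : TangentSpace I.tangent p) :
    lagrangianMetric I L V p (dynamicalK I V p u) (dynamicalK I V p w) =
      -lagrangianMetric I L V p u w := by
  rw [lagrangianMetric_apply, lagrangianMetric_apply,
    lagrangianForm_dynamicalK_left hL.smooth hV p (dynamicalK I V p u),
    dynamicalK_dynamicalK hV]

theorem lagrangianMetric_symm (hL : IsRegularLagrangian I L)
    (hV : IsLagrangianDynamics I L V) (p : TangentBundle I Q) (u w : TangentSpace I.tangent p) :
    lagrangianMetric I L V p u w = lagrangianMetric I L V p w u := by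
  rw [lagrangianMetric_apply, lagrangianMetric_apply, lagrangianForm_dynamicalK_left hL.smooth hV,
    ← lagrangianForm_swap]

theorem lagrangianMetric_eq_zero (hL : IsRegularLagrangian I L)
    (hV : IsLagrangianDynamics I L V) (p : TangentBundle I Q) (u : TangentSpace I.tangent p)
    (h : ∀ w, lagrangianMetric I L V p u w = 0) : u = 0 := by
  rw [← dynamicalK_dynamicalK hV p u,
    hL.nondegenerate p (dynamicalK I V p u) h, map_zero]

theorem isMaximallyIsotropic_eigenDistribution (hL : IsRegularLagrangian I L)
    (hV : IsLagrangianDynamics I L V) (p : TangentBundle I Q) {c : ℝ} (hc : c * c = 1) :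
    IsMaximallyIsotropic (lagrangianMetric I L V p)
      (eigenDistribution I.tangent (dynamicalK I V) c p) :=
  isMaximallyIsotropic_eigenspace (K := (dynamicalK I V p).toLinearMap)
    (lagrangianMetric_dynamicalK_dynamicalK hL hV p) (dynamicalK_dynamicalK hV p)
    (lagrangianMetric_eq_zero hL hV p) hc

variable [FiniteDimensional ℝ E]

omit [I.Boundaryless] in
theorem finrank_tangentSpace_tangent (p : TangentBundle I Q) :
    Module.finrank ℝ (TangentSpace I.tangent p) = 2 * Module.finrank ℝ E :=
  (Module.finrank_prod (R := ℝ) (M := E) (M' := E)).trans (two_mul _).symm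

theorem isMetricOfSignature_lagrangianMetric (hL : IsRegularLagrangian I L)
    (hV : IsLagrangianDynamics I L V) :
    IsMetricOfSignature I.tangent (lagrangianMetric I L V) (Module.finrank ℝ E)
      (Module.finrank ℝ E) := by
  have : CompleteSpace E := FiniteDimensional.complete ℝ E
  have hfin : ∀ p : TangentBundle I Q, FiniteDimensional ℝ (TangentSpace I.tangent p) :=
    fun p => inferInstanceAs (FiniteDimensional ℝ (E × E))
  have hsig := fun p : TangentBundle I Q =>
    sigPos_sigNeg_of_antiIsometry (K := (dynamicalK I V p).toLinearMap)
      (lagrangianMetric_dynamicalK_dynamicalK hL hV p) (dynamicalK_dynamicalK hV p)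
      (lagrangianMetric_symm hL hV p) (lagrangianMetric_eq_zero hL hV p)
      (finrank_tangentSpace_tangent p)
  refine ⟨fun U X Y hU hX hY => ?_, lagrangianMetric_symm hL hV, fun p => ⟨?_, ?_⟩,
    fun p => (hsig p).1, fun p => (hsig p).2⟩
  · exact contMDiffOn_lagrangianForm hL.smooth hU
      (smoothEnd_dynamicalK hV.smooth U X hU hX) hY
  · exact fun u h => lagrangianMetric_eq_zero hL hV p u h
  · exact fun u h => lagrangianMetric_eq_zero hL hV p u fun w =>
      (lagrangianMetric_symm hL hV p u w).trans (h w)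

theorem isPlusParaKahler_lagrangianMetric (hL : IsRegularLagrangian I L)
    (hV : IsLagrangianDynamics I L V) :
    IsPlusParaKahler I.tangent (Module.finrank ℝ E) (dynamicalK I V) (lagrangianMetric I L V)
      (lagrangianForm I L) := by
  have : CompleteSpace E := FiniteDimensional.complete ℝ E
  have hfin : ∀ p : TangentBundle I Q, FiniteDimensional ℝ (TangentSpace I.tangent p) :=
    fun p => inferInstanceAs (FiniteDimensional ℝ (E × E))
  have hplus : ∀ p : TangentBundle I Q,
      Module.finrank ℝ (eigenDistribution I.tangent (dynamicalK I V) 1 p) =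
        Module.finrank ℝ E := fun p => by
    rw [eigenDistribution_dynamicalK_one hV, finrank_verticalDistribution]
  refine ⟨⟨⟨smoothEnd_dynamicalK hV.smooth, ?_, dynamicalK_dynamicalK hV, hplus, fun p => ?_⟩,
    isMetricOfSignature_lagrangianMetric hL hV, lagrangianMetric_dynamicalK_dynamicalK hL hV⟩,
    ?_, fun p u w => ?_, mextDeriv_lagrangianForm hL.smooth⟩
  · exact Module.finrank_prod.trans (two_mul _).symm
  · exact finrank_eigenspace_neg_one (K := (dynamicalK I V p).toLinearMap)
      (dynamicalK_dynamicalK hV p) (finrank_tangentSpace_tangent p) (hplus p)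
  · rw [show eigenDistribution I.tangent (dynamicalK I V) 1 = verticalDistribution I from
      funext (eigenDistribution_dynamicalK_one hV)]
    exact involutive_verticalDistribution
  · rw [lagrangianMetric_apply, dynamicalK_dynamicalK hV]

end FiniteDimensional

theorem mainTheorem1 (d : ℕ)
    {Q : Type*} [TopologicalSpace Q] [ChartedSpace (EuclideanSpace ℝ (Fin d)) Q]
    [IsManifold (𝓡 d) ∞ Q]
    (L : TangentBundle (𝓡 d) Q → ℝ) (hL : IsRegularLagrangian (𝓡 d) L)
    (V : Π p : TangentBundle (𝓡 d) Q, TangentSpace (𝓡 d).tangent p)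
    (hV : IsLagrangianDynamics (𝓡 d) L V) :
    -- `K = £_V S`: the bracket formula holds on all (local) smooth vector fields
    (∀ (U : Set (TangentBundle (𝓡 d) Q))
        (X : Π p : TangentBundle (𝓡 d) Q, TangentSpace (𝓡 d).tangent p),
        IsOpen U → SmoothFieldOn (𝓡 d).tangent X U → ∀ p ∈ U,
          dynamicalK (𝓡 d) V p (X p) =
            VectorField.mlieBracket (𝓡 d).tangent V (fun z => verticalEnd (𝓡 d) z (X z)) p
              - verticalEnd (𝓡 d) p (VectorField.mlieBracket (𝓡 d).tangent V X p)) ∧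
    -- `η_L` is a metric of signature `(d, d)`
    IsMetricOfSignature (𝓡 d).tangent (lagrangianMetric (𝓡 d) L V) d d ∧
    -- the vertical and horizontal distributions are maximally isotropic
    (∀ p : TangentBundle (𝓡 d) Q,
        IsMaximallyIsotropic (lagrangianMetric (𝓡 d) L V p) (verticalDistribution (𝓡 d) p)) ∧
    (∀ p : TangentBundle (𝓡 d) Q,
        IsMaximallyIsotropic (lagrangianMetric (𝓡 d) L V p)
          (horizontalDistribution (𝓡 d) V p)) ∧
    -- `(TQ, K, η_L)` is an `L_v`-para-Kähler manifold with fundamental 2-form `Ω_L`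
    (∀ p : TangentBundle (𝓡 d) Q,
        eigenDistribution (𝓡 d).tangent (dynamicalK (𝓡 d) V) 1 p =
          verticalDistribution (𝓡 d) p) ∧
    IsPlusParaKahler (𝓡 d).tangent d (dynamicalK (𝓡 d) V) (lagrangianMetric (𝓡 d) L V)
      (lagrangianForm (𝓡 d) L) := by
  refine ⟨fun U X hU hX p hp => dynamicalK_eq_mlieBracket hU hX hp, ?_, fun p => ?_, fun p => ?_,
    eigenDistribution_dynamicalK_one hV, ?_⟩
  · simpa only [finrank_euclideanSpace_fin] using isMetricOfSignature_lagrangianMetric hL hV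
  · rw [← eigenDistribution_dynamicalK_one hV]
    exact isMaximallyIsotropic_eigenDistribution hL hV p (by norm_num)
  · exact isMaximallyIsotropic_eigenDistribution hL hV p (by norm_num)
  · simpa only [finrank_euclideanSpace_fin] using isPlusParaKahler_lagrangianMetric hL hV
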